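/- Let $q_1,q_2$ be nonzero complex numbers in the open unit disk such that either $q_1=\overline{q_2}$ or $q_1,q_2\in(0,1)$. Let $r\ge 1$, $s\ge 0$, let $u=(u_1,\dots,u_r)\in\mathbb C^r$ satisfy $$|q_i|\max_{\alpha}|u_\alpha|<\min_{\alpha}|u_\alpha|,\qquad i=1,2,$$ and let $p=(p_1,\dots,p_s)\in\mathbb C^s$. Choose $\rho>0$ with $|u_\alpha|<\rho<|q_i|^{-1}|u_\alpha|$ for all $\alpha=1,\dots,r$ and $i=1,2$, let $C_\rho=\{z\in\mathbb C:|z|=\rho\}$, oriented counterclockwise, and define for $n\ge 0$ $$\mathcal Z_n(u;p)=\frac1{n!}\left(\frac{1-q_1q_2}{(1-q_1)(1-q_2)}\right)^{n}\int_{C_\rho^n}\prod_{j=1}^n\frac{dz_j}{2\pi i z_j}\;\prod_{j=1}^n\prod_{m=1}^s(z_j-p_m)\;\mathcal I(z_1,\dots,z_n;u),$$ $$\mathcal I(z_1,\dots,z_n;u)=\prod_{j=1}^n\prod_{\alpha=1}^r\frac{-u_\alpha z_j}{(z_j-u_\alpha)(q_1q_2z_j-u_\alpha)}\prod_{1\le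 j\ne k\le n}\frac{(z_j-z_k)(z_j-q_1q_2z_k)}{(z_j-q_1z_k)(z_j-q_2z_k)}.$$ Then, for every such choice of $\rho$, $$\limsup_{n\to\infty}|\mathcal Z_n(u;p)|^{1/n}\le\prod_{m=1}^s\max\{|p_m|,|u_1|,\dots,|u_r|\},$$ where the empty product (for $s=0$) equals $1$. -/

import Mathlib

open scoped ENNReal

noncomputable section

namespace Nekrasov

/-- The symmetric function `𝓘(z₁, …, zₙ; u)`:
`∏_j ∏_α (-u_α z_j) / ((z_j - u_α) (q₁ q₂ z_j - u_α))` times the product over all ordered pairs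
`j ≠ k` of `(z_j - z_k) (z_j - q₁ q₂ z_k) / ((z_j - q₁ z_k) (z_j - q₂ z_k))`. -/
def integrand {r n : ℕ} (q₁ q₂ : ℂ) (u : Fin r → ℂ) (z : Fin n → ℂ) : ℂ :=
  (∏ j, ∏ α, (-u α * z j) / ((z j - u α) * (q₁ * q₂ * z j - u α))) *
    ∏ jk ∈ (Finset.univ : Finset (Fin n)).offDiag,
      ((z jk.1 - z jk.2) * (z jk.1 - q₁ * q₂ * z jk.2)) /
        ((z jk.1 - q₁ * z jk.2) * (z jk.1 - q₂ * z jk.2))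

/-- `ρ` is an admissible radius: `|u_α| < ρ < |q_i|⁻¹ |u_α|` for all `α` and `i = 1, 2`. -/
def IsAdmissibleRadius {r : ℕ} (q₁ q₂ : ℂ) (u : Fin r → ℂ) (ρ : ℝ) : Prop :=
  0 < ρ ∧ ∀ α, ‖u α‖ < ρ ∧ ρ < ‖q₁‖⁻¹ * ‖u α‖ ∧ ρ < ‖q₂‖⁻¹ * ‖u α‖

/-- The coefficient `𝓩ₙ(u; p)`, as an `n`-fold contour integral over the circle `|z| = ρ`. -/
def coeff {r s : ℕ} (q₁ q₂ : ℂ) (u : Fin r → ℂ) (p : Fin s → ℂ) (ρ : ℝ) (n : ℕ) : ℂ :=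
  (1 / (n.factorial : ℂ)) * ((1 - q₁ * q₂) / ((1 - q₁) * (1 - q₂))) ^ n *
    torusIntegral
      (fun z : Fin n → ℂ =>
        (∏ j, 1 / (2 * (Real.pi : ℂ) * Complex.I * z j)) *
          (∏ j, ∏ m, (z j - p m)) * integrand q₁ q₂ u z)
      0 (fun _ => ρ)

end Nekrasov

end

/-! On the torus `z_j = ρ x_j`, `|x_j| = 1`, the integral is an average over the eigenvalues of a
random unitary matrix, and its absolute value is controlled by the Gaussian behaviour of traces.

Write `P_m = ∑ x_j ^ m`. The prefactor supplies the diagonal terms `j = k` of the interaction, so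
expanding logarithms gives (`prod_pair_eq`) the modulus `|Δ(x)|² exp(∑ c_m |P_m|² / m)`, where `Δ`
is the Vandermonde determinant and `c_m = Re(q₁^m + q₂^m - (q₁q₂)^m)`. The assumption on `q₁, q₂`
enters through `1 - c_m = Re((1 - q₁^m)(1 - q₂^m)) > 0` (`interactionCoeff_lt_one`). If no `|p_m|`
equals `ρ`, the one-body factors give `(∏ max(|p_m|, ρ))^n` times the exponential of something at
most linear in the `|P_m|`; Young's inequality absorbs this into the quadratic form, keeping its
coefficients `β_m` bounded away from `1` (`tsum_add_le`).

The mixed moments of the `|P_m|²` against `|Δ|²` are at most `n!` times those of independent complex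
Gaussians of variance `m` (`lintegral_powerSums_le`). Hence the integral of `|Δ|² exp(∑ β_m |P_m|² /
m)` is at most `n! ∏ (1 - β_m)⁻¹`, the product being independent of `n`. After division by `n!`, the
coefficient is at most `C (∏ max(|p_m|, ρ))^n` (`exists_enorm_coeff_le`).

Finally the coefficient does not change when the radius shrinks towards `max |u_α|`
(`coeff_eq_of_le`), and letting it do so gives the stated bound. -/

namespace Nekrasov

open AddMonoidAlgebra Equiv

/-! ### Exponents of power sums times the Vandermonde determinant -/

/-- Laurent polynomials in `n` variables. -/
abbrev Laurent (n : ℕ) := AddMonoidAlgebra ℝ (Fin n → ℤ)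

namespace Laurent

variable {n : ℕ}

/-- The power sum `∑ xᵢ ^ m`, for an arbitrary integer `m`. -/
noncomputable def powerSum (n : ℕ) (m : ℤ) : Laurent n := ∑ i, single (Pi.single i m) 1

/-- The Vandermonde determinant. -/
noncomputable def vandermonde (n : ℕ) : Laurent n :=
  ∑ σ : Perm (Fin n), single (fun i => ((σ i : ℕ) : ℤ)) ((Perm.sign σ : ℤ) : ℝ)

/-- The product of power sums indexed by a list, times the Vandermonde determinant. -/
noncomputable def powerProd (n : ℕ) (l : List ℕ) : Laurent n :=
  (l.map fun m : ℕ => powerSum n (m : ℤ)).prod * vandermonde n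

lemma powerProd_nil : powerProd n [] = vandermonde n := by simp [powerProd]

lemma powerProd_cons (m : ℕ) (l : List ℕ) :
    powerProd n (m :: l) = powerSum n m * powerProd n l := by simp [powerProd, mul_assoc]

lemma powerProd_perm {l l' : List ℕ} (h : l.Perm l') : powerProd n l = powerProd n l' := by
  simp only [powerProd]
  rw [(h.map _).prod_eq]

lemma coeff_powerSum_mul (m : ℤ) (g : Laurent n) (α : Fin n → ℤ) :
    (powerSum n m * g).coeff α = ∑ i, g.coeff (α - Pi.single i m) := by
  simp [powerSum, Finset.sum_mul, coeff_sum, Finsupp.finsetSum_apply, neg_add_eq_sub]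

lemma coeff_vandermonde (α : Fin n → ℤ) :
    (vandermonde n).coeff α =
      (Matrix.of fun i j : Fin n => if α j = ((i : ℕ) : ℤ) then (1 : ℝ) else 0).det := by
  classical
  rw [Matrix.det_apply]
  simp only [vandermonde, coeff_sum, Finsupp.finsetSum_apply, coeff_single, Finsupp.single_apply]
  refine Finset.sum_congr rfl fun σ _ => ?_
  simp only [Matrix.of_apply]
  by_cases h : (fun i => ((σ i : ℕ) : ℤ)) = α
  · rw [if_pos h, Finset.prod_eq_one, Units.smul_def]
    · simp
    · intro i _
      simp [← h]
  · rw [if_neg h]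
    obtain ⟨i, hi⟩ : ∃ i, α i ≠ ((σ i : ℕ) : ℤ) := by
      by_contra! h'
      exact h (funext fun i => (h' i).symm)
    rw [Finset.prod_eq_zero (Finset.mem_univ i) (by simp [hi]), smul_zero]

lemma coeff_powerProd_comp (l : List ℕ) (σ : Perm (Fin n)) (α : Fin n → ℤ) :
    (powerProd n l).coeff (α ∘ σ) = ((Perm.sign σ : ℤ) : ℝ) * (powerProd n l).coeff α := by
  induction l generalizing α with
  | nil =>
    rw [powerProd_nil, coeff_vandermonde, coeff_vandermonde]
    exact Matrix.det_permute' σ (Matrix.of fun i j : Fin n => if α j = ((i : ℕ) : ℤ) then (1 : ℝ) else 0)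
  | cons m l ih =>
    rw [powerProd_cons, coeff_powerSum_mul, coeff_powerSum_mul, Finset.mul_sum]
    refine Fintype.sum_equiv σ _ _ fun i => ?_
    rw [← ih]
    congr 1
    ext j
    simp [Pi.single_apply, Function.comp]

/-- A function which is alternating under permutations vanishes at points with a repeated entry. -/
lemma eq_zero_of_alternating {S : (Fin n → ℤ) → ℝ}
    (hS : ∀ (σ : Perm (Fin n)) α, S (α ∘ σ) = ((Perm.sign σ : ℤ) : ℝ) * S α)
    {α : Fin n → ℤ} {i j : Fin n} (hij : i ≠ j) (h : α i = α j) : S α = 0 := by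
  have h1 : α ∘ (swap i j) = α := by
    ext k
    simp only [Function.comp, swap_apply_def]
    split_ifs with h1 h2
    · rw [h1, h]
    · rw [h2, h]
    · rfl
  have := hS (swap i j) α
  rw [h1, Perm.sign_swap hij] at this
  simp at this
  linarith

lemma injective_of_coeff_powerProd_ne_zero {l : List ℕ} {α : Fin n → ℤ}
    (h : (powerProd n l).coeff α ≠ 0) : Function.Injective α := by
  intro i j hij
  by_contra hne
  exact h (eq_zero_of_alternating (coeff_powerProd_comp l) hne hij)

lemma exists_perm_of_coeff_vandermonde_ne_zero {α : Fin n → ℤ}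
    (h : (vandermonde n).coeff α ≠ 0) : ∃ σ : Perm (Fin n), ∀ i, α i = ((σ i : ℕ) : ℤ) := by
  classical
  by_contra! h'
  apply h
  simp only [vandermonde, coeff_sum, Finsupp.finsetSum_apply, coeff_single, Finsupp.single_apply]
  refine Finset.sum_eq_zero fun σ _ => if_neg fun h2 => ?_
  obtain ⟨i, hi⟩ := h' σ
  exact hi (congrFun h2 i).symm

lemma nonneg_of_coeff_powerProd_ne_zero {l : List ℕ} {α : Fin n → ℤ}
    (h : (powerProd n l).coeff α ≠ 0) (i : Fin n) : 0 ≤ α i := by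
  induction l generalizing α with
  | nil =>
    rw [powerProd_nil] at h
    obtain ⟨σ, hσ⟩ := exists_perm_of_coeff_vandermonde_ne_zero h
    rw [hσ]; positivity
  | cons m l ih =>
    rw [powerProd_cons, coeff_powerSum_mul] at h
    obtain ⟨j, -, hj⟩ := Finset.exists_ne_zero_of_sum_ne_zero h
    have := ih hj
    have h2 : (0 : ℤ) ≤ (Pi.single j (m : ℤ) : Fin n → ℤ) i := by
      rw [Pi.single_apply]; split_ifs <;> positivity
    simp only [Pi.sub_apply] at this
    linarith

/-- The exponents occurring in `powerProd n l` contain all small values. -/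
lemma exists_eq_of_coeff_powerProd_ne_zero {l : List ℕ} {α : Fin n → ℤ}
    (h : (powerProd n l).coeff α ≠ 0) {v : ℤ} (hv : 0 ≤ v) (hvl : v + l.sum < n) :
    ∃ i, α i = v := by
  induction l generalizing α v with
  | nil =>
    rw [powerProd_nil] at h
    obtain ⟨σ, hσ⟩ := exists_perm_of_coeff_vandermonde_ne_zero h
    lift v to ℕ using hv
    have hvn : v < n := by simp at hvl; omega
    exact ⟨σ.symm ⟨v, hvn⟩, by rw [hσ]; simp⟩
  | cons m l ih =>
    have hinj := injective_of_coeff_powerProd_ne_zero h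
    rw [powerProd_cons, coeff_powerSum_mul] at h
    obtain ⟨j, -, hj⟩ := Finset.exists_ne_zero_of_sum_ne_zero h
    simp only [List.sum_cons, Nat.cast_add] at hvl
    obtain ⟨i, hi⟩ := ih hj hv (by omega)
    -- If `v` sat at the incremented place `j`, then `α j = v + m`. Before the increment `v + m` was
    -- also present; it sat at `j` only if `m = 0`, and otherwise it would now be repeated in `α`,
    -- against injectivity.
    by_cases hij : i = j
    · subst hij
      obtain ⟨i', hi'⟩ := ih hj (v := v + m) (by omega) (by omega)
      simp only [Pi.sub_apply, Pi.single_eq_same] at hi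
      by_cases hii : i' = i
      · subst hii
        simp only [Pi.sub_apply, Pi.single_eq_same] at hi'
        exact ⟨i', by omega⟩
      · simp only [Pi.sub_apply, Pi.single_eq_of_ne hii] at hi'
        exact absurd (hinj (by omega : α i' = α i)) hii
    · simp only [Pi.sub_apply, Pi.single_eq_of_ne hij] at hi
      exact ⟨i, by omega⟩

/-! ### The adjoint of multiplication by a power sum -/

/-- This is the commutator of multiplication by `P_k` with the adjoint of `P_m`: the terms in which
an exponent becomes negative and is then repaired. With enough variables it is the Heisenberg
relation. -/
lemma sum_filter_coeff_powerProd {l : List ℕ} {m k : ℕ} (hl : k + l.sum ≤ n) {α : Fin n → ℤ}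
    (hα : ∀ i, 0 ≤ α i) :
    (∑ i, if α i < k then (powerProd n l).coeff (α - Pi.single i (k : ℤ) + Pi.single i (m : ℤ))
      else 0) = if m = k then (k : ℝ) * (powerProd n l).coeff α else 0 := by
  classical
  by_cases hmk : m = k
  · subst hmk
    simp only [sub_add_cancel, if_true]
    by_cases h : (powerProd n l).coeff α = 0
    · simp [h]
    have hinj := injective_of_coeff_powerProd_ne_zero h
    rw [← Finset.sum_filter, Finset.sum_const, nsmul_eq_mul]
    congr 2
    -- The exponents are distinct and contain each of `0, …, m - 1`, so exactly `m` indices satisfy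
    -- the condition.
    have : ∀ v : Fin m, ∃ i, α i = ((v : ℕ) : ℤ) := fun v =>
      exists_eq_of_coeff_powerProd_ne_zero h (by positivity) (by have := v.2; omega)
    choose f hf using this
    have himg : Finset.univ.filter (fun i => α i < m) = Finset.univ.image f := by
      ext i
      simp only [Finset.mem_filter, Finset.mem_univ, true_and, Finset.mem_image]
      constructor
      · intro hi
        have h0 := hα i
        refine ⟨⟨(α i).toNat, by omega⟩, hinj ?_⟩
        rw [hf]
        simp [h0]
      · rintro ⟨v, rfl⟩
        rw [hf]
        exact_mod_cast v.2
    rw [himg, Finset.card_image_of_injective, Finset.card_univ, Fintype.card_fin]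
    intro v w hvw
    have := hf v
    rw [hvw, hf w] at this
    exact Fin.ext (by omega)
  · rw [if_neg hmk]
    by_contra hne
    set S : (Fin n → ℤ) → ℝ := fun α => ∑ i, if α i < k then
      (powerProd n l).coeff (α - Pi.single i (k : ℤ) + Pi.single i (m : ℤ)) else 0 with hSdef
    have hS : ∀ (σ : Perm (Fin n)) α, S (α ∘ σ) = ((Perm.sign σ : ℤ) : ℝ) * S α := by
      intro σ α
      simp only [hSdef]
      rw [Finset.mul_sum]
      refine Fintype.sum_equiv σ _ _ fun i => ?_
      simp only [Function.comp_apply, mul_ite, mul_zero]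
      congr 1
      rw [← coeff_powerProd_comp]
      congr 1
      ext j
      simp [Pi.single_apply, Function.comp]
    obtain ⟨i, -, hi⟩ := Finset.exists_ne_zero_of_sum_ne_zero hne
    rw [Ne, ite_eq_right_iff, Classical.not_imp] at hi
    obtain ⟨hik, hi⟩ := hi
    -- The small value `α i` must still occur after place `i` has been shifted by `m - k ≠ 0`. It
    -- then occurs elsewhere, so `α` has a repeated entry and the alternating sum `S` vanishes.
    obtain ⟨j, hj⟩ := exists_eq_of_coeff_powerProd_ne_zero hi (hα i) (by omega)
    by_cases hij : j = i
    · subst hij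
      simp at hj
      omega
    · simp [Pi.single_eq_of_ne hij] at hj
      exact hne (eq_zero_of_alternating hS (fun h => hij h.symm) hj.symm)

/-- The operator adjoint to multiplication by a power sum acts on `powerProd n l` as a
derivation, provided that there are enough variables. -/
lemma coeff_powerSum_neg_mul {l : List ℕ} (hl : l.sum ≤ n) (hpos : ∀ k ∈ l, 0 < k) {m : ℕ}
    (hm : 0 < m) {α : Fin n → ℤ} (hα : ∀ i, 0 ≤ α i) :
    (powerSum n (-m) * powerProd n l).coeff α =
      m * l.count m * (powerProd n (l.erase m)).coeff α := by
  classical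
  induction l generalizing α with
  | nil =>
    simp only [List.count_nil, Nat.cast_zero, mul_zero, zero_mul]
    by_contra hne
    have hS : ∀ (σ : Perm (Fin n)) α, (powerSum n (-m) * powerProd n []).coeff (α ∘ σ) =
        ((Perm.sign σ : ℤ) : ℝ) * (powerSum n (-m) * powerProd n []).coeff α := by
      intro σ α
      rw [coeff_powerSum_mul, coeff_powerSum_mul, Finset.mul_sum]
      refine Fintype.sum_equiv σ _ _ fun i => ?_
      rw [← coeff_powerProd_comp]
      congr 1
      ext j
      simp [Pi.single_apply, Function.comp]
    have hne' := hne
    rw [coeff_powerSum_mul] at hne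
    obtain ⟨i, -, hi⟩ := Finset.exists_ne_zero_of_sum_ne_zero hne
    have hi' := hi
    rw [powerProd_nil] at hi'
    obtain ⟨σ, hσ⟩ := exists_perm_of_coeff_vandermonde_ne_zero hi'
    have h1 := hσ i
    have h2 := (σ i).2
    simp at h1
    -- Exponents of the Vandermonde determinant fill `0, …, n - 1`; raising one of them by `m` while
    -- staying below `n` collides with another.
    obtain ⟨j, hj⟩ := exists_eq_of_coeff_powerProd_ne_zero hi (hα i) (by simp; omega)
    by_cases hij : j = i
    · subst hij
      simp at hj
      omega
    · simp [Pi.single_eq_of_ne hij] at hj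
      exact hne' (eq_zero_of_alternating hS (fun h => hij h.symm) hj.symm)
  | cons k l ih =>
    simp only [List.sum_cons] at hl
    have hk : 0 < k := hpos k (by simp)
    have ih' := fun {α : Fin n → ℤ} => ih (by omega) (fun k hk => hpos k (by simp [hk])) (α := α)
    have e1 : (powerSum n (-m) * powerProd n (k :: l)).coeff α =
        ∑ i, (powerSum n (-m) * powerProd n l).coeff (α - Pi.single i (k : ℤ)) := by
      rw [powerProd_cons, mul_left_comm, coeff_powerSum_mul]
    -- The induction hypothesis needs nonnegative exponents. When `α i < k`, place `i` is negative
    -- and only the `i`-th summand of `powerSum n (-m)` can repair it.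
    have e2 : ∀ i, (powerSum n (-m) * powerProd n l).coeff (α - Pi.single i (k : ℤ)) =
        m * l.count m * (powerProd n (l.erase m)).coeff (α - Pi.single i (k : ℤ)) +
        if α i < k then (powerProd n l).coeff (α - Pi.single i (k : ℤ) + Pi.single i (m : ℤ))
          else 0 := by
      intro i
      by_cases h : α i < k
      · rw [if_pos h]
        have h0 : (powerProd n (l.erase m)).coeff (α - Pi.single i (k : ℤ)) = 0 := by
          by_contra h0
          have := nonneg_of_coeff_powerProd_ne_zero h0 i
          simp at this
          omega
        rw [h0, mul_zero, zero_add, coeff_powerSum_mul, Finset.sum_eq_single i]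
        · congr 1
          ext j
          simp [Pi.single_apply]
          split_ifs <;> ring
        · intro j _ hj
          by_contra h0
          have := nonneg_of_coeff_powerProd_ne_zero h0 i
          simp [Pi.single_eq_of_ne hj.symm] at this
          omega
        · simp
      · rw [if_neg h, add_zero]
        refine ih' fun j => ?_
        have := hα j
        by_cases hj : j = i
        · subst hj; simp; omega
        · simpa [Pi.single_eq_of_ne hj] using this
    rw [e1, Finset.sum_congr rfl fun i _ => e2 i, Finset.sum_add_distrib,
      sum_filter_coeff_powerProd hl hα, ← Finset.mul_sum, ← coeff_powerSum_mul, ← powerProd_cons]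
    by_cases hmk : m = k
    · subst hmk
      simp only [List.count_cons_self, List.erase_cons_head, if_true]
      by_cases hml : m ∈ l
      · rw [powerProd_perm (List.perm_cons_erase hml).symm]
        push_cast; ring
      · rw [List.count_eq_zero_of_not_mem hml]
        push_cast; ring
    · rw [if_neg hmk, List.erase_cons_tail (by simpa using fun h => hmk h.symm),
        List.count_cons_of_ne (fun h => hmk h.symm)]
      ring

/-! ### Norms for the orthonormal pairing of monomials -/

/-- The pairing for which the monomials are orthonormal. -/
noncomputable def pairing (f g : Laurent n) : ℝ := f.coeff.sum fun α a => a * g.coeff α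

lemma pairing_add_left (f f' g : Laurent n) :
    pairing (f + f') g = pairing f g + pairing f' g := by
  unfold pairing
  rw [coeff_add, Finsupp.sum_add_index']
  · simp
  · intros; ring

lemma pairing_zero_left (g : Laurent n) : pairing 0 g = 0 := by simp [pairing]

lemma pairing_sum_left {ι : Type*} (s : Finset ι) (f : ι → Laurent n) (g : Laurent n) :
    pairing (∑ i ∈ s, f i) g = ∑ i ∈ s, pairing (f i) g := by
  classical
  induction s using Finset.induction_on with
  | empty => simp [pairing_zero_left]
  | insert a s ha ih => rw [Finset.sum_insert ha, Finset.sum_insert ha, pairing_add_left, ih]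

lemma pairing_single_left (α : Fin n → ℤ) (a : ℝ) (g : Laurent n) :
    pairing (single α a) g = a * g.coeff α := by
  simp [pairing, Finsupp.sum_single_index]

lemma pairing_powerSum_mul (m : ℤ) (f g : Laurent n) :
    pairing (powerSum n m * f) g = pairing f (powerSum n (-m) * g) := by
  induction f using AddMonoidAlgebra.induction_linear with
  | zero => simp [pairing_zero_left]
  | add f f' h h' => rw [mul_add, pairing_add_left, pairing_add_left, h, h']
  | single α a =>
    rw [pairing_single_left, coeff_powerSum_mul, powerSum, Finset.sum_mul, pairing_sum_left,
      Finset.mul_sum]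
    refine Finset.sum_congr rfl fun i _ => ?_
    rw [single_mul_single, one_mul, pairing_single_left]
    congr 2
    ext j
    simp [Pi.single_apply]
    split_ifs <;> ring

lemma pairing_congr {f g g' : Laurent n} (h : ∀ α, f.coeff α ≠ 0 → g.coeff α = g'.coeff α) :
    pairing f g = pairing f g' := by
  refine Finset.sum_congr rfl fun α hα => ?_
  simp only
  rw [h α (Finsupp.mem_support_iff.1 hα)]

/-- For a partition `l` this is `∏ m ^ kₘ * kₘ!`, where `kₘ` is the multiplicity of `m`. -/
def zee : List ℕ → ℕ
  | [] => 1
  | m :: l => m * (l.count m + 1) * zee l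

lemma pairing_smul_right (c : ℝ) (f g : Laurent n) : pairing f (c • g) = c * pairing f g := by
  simp only [pairing, Finsupp.mul_sum, coeff_smul_apply, smul_eq_mul]
  exact Finset.sum_congr rfl fun _ _ => by ring

lemma pairing_vandermonde : pairing (vandermonde n) (vandermonde n) = n.factorial := by
  have : ∀ σ : Perm (Fin n), pairing (single (fun i => ((σ i : ℕ) : ℤ)) ((Perm.sign σ : ℤ) : ℝ))
      (vandermonde n) = 1 := by
    intro σ
    rw [pairing_single_left]
    have : (vandermonde n).coeff (fun i => ((σ i : ℕ) : ℤ)) = ((Perm.sign σ : ℤ) : ℝ) := by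
      classical
      simp only [vandermonde, coeff_sum, Finsupp.finsetSum_apply, coeff_single,
        Finsupp.single_apply]
      rw [Finset.sum_eq_single σ]
      · simp
      · intro τ _ hτ
        refine if_neg fun h => hτ ?_
        ext i
        have := congrFun h i
        simp at this
        omega
      · simp
    rw [this]
    rcases Int.units_eq_one_or (Perm.sign σ) with h | h <;> simp [h]
  conv_lhs => arg 1; rw [vandermonde]
  rw [pairing_sum_left, Finset.sum_congr rfl fun σ _ => this σ]
  simp [Fintype.card_perm]

/-- Moving one part `m` across the pairing turns it into the derivation of `coeff_powerSum_neg_mul`,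
which removes it at the cost of the factor `m` times its multiplicity. -/
lemma pairing_powerProd_self {l : List ℕ} (hl : l.sum ≤ n) (hpos : ∀ k ∈ l, 0 < k) :
    pairing (powerProd n l) (powerProd n l) = n.factorial * zee l := by
  induction l with
  | nil => rw [powerProd_nil, pairing_vandermonde]; simp [zee]
  | cons m l ih =>
    conv_lhs => rw [powerProd_cons, pairing_powerSum_mul, ← powerProd_cons]
    have hsum := hl
    simp only [List.sum_cons] at hl
    -- The derivation formula holds only at nonnegative exponents, but the left argument of the
    -- pairing is supported there.
    rw [pairing_congr (g' := ((m : ℝ) * (l.count m + 1)) • powerProd n l), pairing_smul_right,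
      ih (by omega) fun k hk => hpos k (by simp [hk])]
    · simp only [zee]; push_cast; ring
    · intro α hα
      rw [coeff_powerSum_neg_mul hsum hpos (hpos m (by simp))
        (nonneg_of_coeff_powerProd_ne_zero hα)]
      simp

/-! ### Monotonicity in the number of variables -/

/-- A coordinate with final exponent `0` cannot have received a positive part, so the power sums act
on the other variables only; there the Vandermonde exponents are shifted by one. -/
lemma coeff_powerProd_cons_zero (l : List ℕ) (hpos : ∀ k ∈ l, 0 < k) (α : Fin n → ℤ) :
    (powerProd (n + 1) l).coeff (Fin.cons 0 (fun i => α i + 1)) = (powerProd n l).coeff α := by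
  classical
  induction l generalizing α with
  | nil =>
    rw [powerProd_nil, powerProd_nil, coeff_vandermonde, coeff_vandermonde,
      Matrix.det_succ_column_zero, Finset.sum_eq_single 0]
    · simp only [Fin.val_zero, pow_zero, Matrix.of_apply, Fin.cons_zero, one_mul]
      simp only [Nat.cast_zero, if_true, one_mul]
      congr 1
      ext i j
      simp [Matrix.submatrix_apply]
    · intro i _ hi
      have : (0 : ℤ) ≠ ((i : ℕ) : ℤ) := by
        intro h
        exact hi (Fin.ext (by simpa using h.symm))
      simp [this]
    · simp
  | cons m l ih =>
    have hm := hpos m (by simp)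
    rw [powerProd_cons, powerProd_cons, coeff_powerSum_mul, coeff_powerSum_mul, Fin.sum_univ_succ]
    rw [show (powerProd (n + 1) l).coeff ((Fin.cons 0 fun i => α i + 1) - Pi.single 0 (m : ℤ)) = 0
      from ?_, zero_add]
    · refine Finset.sum_congr rfl fun i _ => ?_
      rw [← ih (fun k hk => hpos k (by simp [hk]))]
      congr 1
      ext j
      refine Fin.cases ?_ (fun j => ?_) j
      · simp [Pi.single_apply]
      · simp [Pi.single_apply]
        split_ifs <;> ring
    · by_contra h0
      have := nonneg_of_coeff_powerProd_ne_zero h0 0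
      simp at this
      omega

lemma pairing_self (g : Laurent n) :
    pairing g g = ∑ α ∈ g.coeff.support, g.coeff α ^ 2 :=
  Finset.sum_congr rfl fun _ _ => by simp only [sq]

/-- Each exponent in `n` variables yields `n + 1` exponents in `n + 1` variables, according to the
place of the new entry `0`. The others are raised above `0`, so these are all distinct, and their
coefficients agree up to sign. -/
lemma succ_mul_pairing_powerProd_le (l : List ℕ) (hpos : ∀ k ∈ l, 0 < k) :
    (n + 1) * pairing (powerProd n l) (powerProd n l) ≤
      pairing (powerProd (n + 1) l) (powerProd (n + 1) l) := by
  classical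
  rw [pairing_self, pairing_self]
  set B := (powerProd n l).coeff.support
  let ι : Fin (n + 1) × (Fin n → ℤ) → (Fin (n + 1) → ℤ) := fun x =>
    (Fin.cons 0 (fun i => x.2 i + 1) : Fin (n + 1) → ℤ) ∘ swap 0 x.1
  have hι : ∀ x, (powerProd (n + 1) l).coeff (ι x) ^ 2 = (powerProd n l).coeff x.2 ^ 2 := by
    intro x
    simp only [ι]
    rw [coeff_powerProd_comp, coeff_powerProd_cons_zero l hpos]
    rcases Int.units_eq_one_or (Perm.sign (swap 0 x.1)) with h | h <;> simp [h]
  have hinj : Set.InjOn ι (Finset.univ ×ˢ B : Finset (Fin (n + 1) × (Fin n → ℤ))) := by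
    rintro ⟨k, α⟩ hα ⟨k', α'⟩ hα' h
    simp only [Finset.coe_product, Finset.coe_univ, Set.mem_prod, Set.mem_univ, true_and,
      Finset.mem_coe, B, Finsupp.mem_support_iff] at hα hα'
    have hkk : k = k' := by
      have h1 := congrFun h k
      simp only [ι, Function.comp_apply, swap_apply_right, Fin.cons_zero] at h1
      have h2 : swap 0 k' k = 0 := by
        by_contra h2
        obtain ⟨j, hj⟩ := Fin.exists_succ_eq.2 h2
        rw [← hj, Fin.cons_succ] at h1
        have := nonneg_of_coeff_powerProd_ne_zero hα' j
        omega
      have h3 := congrArg (swap 0 k') h2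
      simpa using h3
    subst hkk
    refine Prod.ext rfl ?_
    ext i
    have h1 := congrFun h (swap 0 k i.succ)
    simpa [ι] using h1
  calc ((n : ℝ) + 1) * ∑ α ∈ B, (powerProd n l).coeff α ^ 2
      = ∑ x ∈ (Finset.univ ×ˢ B : Finset (Fin (n + 1) × (Fin n → ℤ))),
          (powerProd (n + 1) l).coeff (ι x) ^ 2 := by
        rw [Finset.sum_product]
        simp [hι]
    _ = ∑ β ∈ (Finset.univ ×ˢ B).image ι, (powerProd (n + 1) l).coeff β ^ 2 := by
        rw [Finset.sum_image hinj]
    _ ≤ _ := by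
        refine Finset.sum_le_sum_of_subset_of_nonneg ?_ fun _ _ _ => sq_nonneg _
        intro β hβ
        obtain ⟨x, hx, rfl⟩ := Finset.mem_image.1 hβ
        rw [Finsupp.mem_support_iff, ← sq_eq_zero_iff.ne, hι]
        have := (Finset.mem_product.1 hx).2
        simpa [B] using this

/-- With few variables the exact formula fails, but the norm divided by `n!` increases with `n` and
equals `zee l` once `l.sum` variables have been added. -/
lemma pairing_powerProd_self_le (n : ℕ) (l : List ℕ) (hpos : ∀ k ∈ l, 0 < k) :
    pairing (powerProd n l) (powerProd n l) ≤ n.factorial * zee l := by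
  have key : ∀ k : ℕ, pairing (powerProd n l) (powerProd n l) * (n + k).factorial ≤
      pairing (powerProd (n + k) l) (powerProd (n + k) l) * n.factorial := by
    intro k
    induction k with
    | zero => simp
    | succ k ih =>
      have h1 := succ_mul_pairing_powerProd_le (n := n + k) l hpos
      rw [← add_assoc, Nat.factorial_succ]
      push_cast at h1 ⊢
      calc _ = ((n : ℝ) + k + 1) *
            (pairing (powerProd n l) (powerProd n l) * (n + k).factorial) := by ring
        _ ≤ ((n : ℝ) + k + 1) *
            (pairing (powerProd (n + k) l) (powerProd (n + k) l) * n.factorial) := by gcongr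
        _ = (((n : ℝ) + k + 1) * pairing (powerProd (n + k) l) (powerProd (n + k) l)) *
            n.factorial := by ring
        _ ≤ _ := by gcongr
  have h := key l.sum
  rw [pairing_powerProd_self (n := n + l.sum) (by omega) hpos] at h
  have hp : (0 : ℝ) < (n + l.sum).factorial := by positivity
  refine le_of_mul_le_mul_right (h.trans_eq ?_) hp
  ring

end Laurent
end Nekrasov

/-! ### Evaluation on the torus and Parseval's identity -/

namespace Nekrasov

open AddMonoidAlgebra Equiv MeasureTheory

/-- The Haar probability measure on the torus. -/
noncomputable abbrev torusHaar (n : ℕ) : Measure (Fin n → UnitAddCircle) :=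
  Measure.pi fun _ => AddCircle.haarAddCircle

lemma integrable_torusHaar {n : ℕ} {f : (Fin n → UnitAddCircle) → ℂ} (hf : Continuous f) :
    Integrable f (torusHaar n) :=
  hf.integrable_of_hasCompactSupport (HasCompactSupport.of_compactSpace _)

lemma fourier_eq_zpow (m : ℤ) (x : UnitAddCircle) : fourier m x = (fourier 1 x : ℂ) ^ m := by
  simp [fourier_apply, AddCircle.toCircle_zsmul]

lemma norm_fourier (m : ℤ) (x : UnitAddCircle) : ‖(fourier m x : ℂ)‖ = 1 := by
  rw [fourier_apply]
  exact Circle.norm_coe _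

lemma integral_fourier (m : ℤ) :
    ∫ x : UnitAddCircle, (fourier m x : ℂ) ∂AddCircle.haarAddCircle = if m = 0 then 1 else 0 := by
  split_ifs with h
  · simp [h]
  · exact integral_eq_zero_of_add_right_eq_neg (μ := AddCircle.haarAddCircle)
      (fourier_add_half_inv_index h one_pos)

lemma integral_mFourier {n : ℕ} (α : Fin n → ℤ) :
    ∫ x, UnitAddTorus.mFourier α x ∂(torusHaar n) = if α = 0 then 1 else 0 := by
  simp only [UnitAddTorus.mFourier, ContinuousMap.coe_mk]
  rw [integral_fintype_prod_eq_prod (𝕜 := ℂ) (fun i (x : UnitAddCircle) => fourier (α i) x)]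
  simp only [integral_fourier]
  by_cases h : α = 0
  · simp [h]
  · obtain ⟨i, hi⟩ := Function.ne_iff.1 h
    rw [if_neg h, Finset.prod_eq_zero (Finset.mem_univ i)]
    simpa using hi

/-- The power sum `∑ xᵢ ^ m` of points of the unit circle. -/
noncomputable def circlePowerSum {n : ℕ} (x : Fin n → UnitAddCircle) (m : ℕ) : ℂ :=
  ∑ i, (fourier 1 (x i) : ℂ) ^ m

/-- The squared modulus of the Vandermonde determinant of points of the unit circle. -/
noncomputable def vandermondeWeight {n : ℕ} (x : Fin n → UnitAddCircle) : ℝ :=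
  ‖(Matrix.vandermonde fun i => (fourier 1 (x i) : ℂ)).det‖ ^ 2

namespace Laurent

variable {n : ℕ}

/-- Evaluation of a Laurent polynomial at a point of the torus. -/
noncomputable def eval (x : Fin n → UnitAddCircle) : Laurent n →ₐ[ℝ] ℂ :=
  lift ℝ ℂ _
    { toFun := fun α => UnitAddTorus.mFourier α.toAdd x
      map_one' := by simp [UnitAddTorus.mFourier_zero]
      map_mul' := fun α β => by simp [UnitAddTorus.mFourier_add] }

lemma eval_eq_sum (x : Fin n → UnitAddCircle) (f : Laurent n) :
    eval x f = ∑ α ∈ f.coeff.support, (f.coeff α : ℂ) * UnitAddTorus.mFourier α x := by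
  simp [eval, lift_apply, Finsupp.sum]

lemma eval_single (x : Fin n → UnitAddCircle) (α : Fin n → ℤ) (a : ℝ) :
    eval x (single α a) = a * UnitAddTorus.mFourier α x := by
  simp [eval]

lemma eval_powerSum (x : Fin n → UnitAddCircle) (m : ℕ) :
    eval x (powerSum n m) = circlePowerSum x m := by
  simp only [powerSum, map_sum, eval_single, circlePowerSum]
  refine Finset.sum_congr rfl fun i _ => ?_
  simp only [UnitAddTorus.mFourier, ContinuousMap.coe_mk, Complex.ofReal_one, one_mul]
  rw [Finset.prod_eq_single i]
  · rw [Pi.single_eq_same, fourier_eq_zpow, zpow_natCast]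
  · intro j _ hj
    simp [Pi.single_eq_of_ne hj]
  · simp

lemma eval_vandermonde (x : Fin n → UnitAddCircle) :
    eval x (vandermonde n) = (Matrix.vandermonde fun i => (fourier 1 (x i) : ℂ)).det := by
  rw [← Matrix.det_transpose, Matrix.det_apply]
  simp only [vandermonde, map_sum, eval_single]
  refine Finset.sum_congr rfl fun σ _ => ?_
  simp only [UnitAddTorus.mFourier, ContinuousMap.coe_mk, Matrix.transpose_apply,
    Matrix.vandermonde_apply, Units.smul_def, zsmul_eq_mul]
  congr 1
  exact Finset.prod_congr rfl fun i _ => by rw [fourier_eq_zpow, zpow_natCast]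

lemma norm_eval_powerProd_sq (x : Fin n → UnitAddCircle) (l : List ℕ) :
    ‖eval x (powerProd n l)‖ ^ 2 =
      (l.map fun m => ‖circlePowerSum x m‖ ^ 2).prod * vandermondeWeight x := by
  induction l with
  | nil => simp [powerProd_nil, eval_vandermonde, vandermondeWeight]
  | cons m l ih =>
    rw [powerProd_cons, map_mul, eval_powerSum, norm_mul, mul_pow, ih]
    simp [mul_assoc]

lemma continuous_eval (f : Laurent n) : Continuous fun x => eval x f := by
  simp only [eval_eq_sum]
  fun_prop

/-- Parseval's identity for Laurent polynomials. -/
lemma integral_norm_eval_sq (f : Laurent n) :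
    ∫ x, ‖eval x f‖ ^ 2 ∂(torusHaar n) = pairing f f := by
  classical
  have h1 : ∀ x, ((‖eval x f‖ ^ 2 : ℝ) : ℂ) = ∑ α ∈ f.coeff.support, ∑ β ∈ f.coeff.support,
      ((f.coeff α : ℂ) * f.coeff β) * UnitAddTorus.mFourier (α - β) x := by
    intro x
    rw [Complex.ofReal_pow, ← Complex.mul_conj', eval_eq_sum, map_sum, Finset.sum_mul_sum]
    refine Finset.sum_congr rfl fun α _ => Finset.sum_congr rfl fun β _ => ?_
    rw [sub_eq_add_neg, UnitAddTorus.mFourier_add, UnitAddTorus.mFourier_neg, map_mul,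
      Complex.conj_ofReal]
    ring
  apply Complex.ofReal_injective
  rw [← integral_complex_ofReal]
  simp only [h1]
  rw [integral_finsetSum _ fun α _ => integrable_torusHaar (by fun_prop), pairing_self]
  push_cast
  refine Finset.sum_congr rfl fun α hα => ?_
  rw [integral_finsetSum _ fun β _ => integrable_torusHaar (by fun_prop),
    Finset.sum_eq_single α]
  · rw [integral_const_mul, integral_mFourier]; simp [sq]
  · intro β _ hβ
    rw [integral_const_mul, integral_mFourier, if_neg (sub_ne_zero.2 hβ.symm), mul_zero]
  · exact fun h => absurd hα h

end Laurent

variable {n : ℕ}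

lemma vandermondeWeight_nonneg (x : Fin n → UnitAddCircle) : 0 ≤ vandermondeWeight x := sq_nonneg _

lemma continuous_circlePowerSum (m : ℕ) :
    Continuous fun x : Fin n → UnitAddCircle => circlePowerSum x m := by
  unfold circlePowerSum; fun_prop

lemma continuous_vandermondeWeight :
    Continuous fun x : Fin n → UnitAddCircle => vandermondeWeight x := by
  unfold vandermondeWeight
  simp only [Matrix.det_vandermonde]
  fun_prop

lemma prod_norm_sq_nonneg (x : Fin n → UnitAddCircle) (l : List ℕ) :
    0 ≤ (l.map fun m => ‖circlePowerSum x m‖ ^ 2).prod :=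
  List.prod_nonneg (by simp)

/-! ### Gaussian bounds for moments and exponential moments -/

/-- The moments of the traces of a random unitary matrix are at most the Gaussian ones. -/
lemma lintegral_powerSums_le (l : List ℕ) (hpos : ∀ k ∈ l, 0 < k) :
    ∫⁻ x, ENNReal.ofReal ((l.map fun m => ‖circlePowerSum x m‖ ^ 2).prod * vandermondeWeight x)
      ∂(torusHaar n) ≤ ENNReal.ofReal (n.factorial * Laurent.zee l) := by
  simp only [← Laurent.norm_eval_powerProd_sq]
  rw [← ofReal_integral_eq_lintegral_ofReal]
  · exact ENNReal.ofReal_le_ofReal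
      ((Laurent.integral_norm_eval_sq _).trans_le (Laurent.pairing_powerProd_self_le n l hpos))
  · exact ((Laurent.continuous_eval _).norm.pow 2).integrable_of_hasCompactSupport
      (HasCompactSupport.of_compactSpace _)
  · exact Filter.Eventually.of_forall fun x => sq_nonneg _

lemma Laurent.zee_replicate_append (m k : ℕ) (l : List ℕ) (h : m ∉ l) :
    zee (List.replicate k m ++ l) = m ^ k * k.factorial * zee l := by
  induction k with
  | zero => simp
  | succ k ih =>
    rw [List.replicate_succ, List.cons_append, zee, ih, List.count_append,
      List.count_replicate_self, List.count_eq_zero_of_not_mem h, Nat.factorial_succ]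
    ring

/-- Induction on `N`, expanding the exponential in the last power sum. Its `k`-th term adds `k`
parts `N + 1` to `l`, and the new factor `(N + 1)^k k!` of `zee` cancels the denominators, leaving a
geometric series in `β N`. The list `l` carries the parts already expanded. -/
lemma lintegral_powerSums_mul_exp_le (β : ℕ → ℝ) (h0 : ∀ m, 0 ≤ β m) (h1 : ∀ m, β m < 1) (N : ℕ)
    (l : List ℕ) (hl : ∀ k ∈ l, N < k) :
    ∫⁻ x, ENNReal.ofReal ((l.map fun m => ‖circlePowerSum x m‖ ^ 2).prod * vandermondeWeight x *
        ∏ m ∈ Finset.range N, Real.exp (β m * ‖circlePowerSum x (m + 1)‖ ^ 2 / (m + 1 : ℕ)))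
      ∂(torusHaar n) ≤
    ENNReal.ofReal (n.factorial * Laurent.zee l * ∏ m ∈ Finset.range N, (1 - β m)⁻¹) := by
  induction N generalizing l with
  | zero => simpa using lintegral_powerSums_le l hl
  | succ N ih =>
    set E : (Fin n → UnitAddCircle) → ℝ := fun x => ∏ m ∈ Finset.range N,
      Real.exp (β m * ‖circlePowerSum x (m + 1)‖ ^ 2 / (m + 1 : ℕ)) with hE
    have hE0 : ∀ x, 0 ≤ E x := fun x => Finset.prod_nonneg fun _ _ => (Real.exp_pos _).le
    set b := β N with hb
    set R : ℝ := n.factorial * Laurent.zee l * ∏ m ∈ Finset.range N, (1 - β m)⁻¹ with hR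
    have hR0 : 0 ≤ R := by
      have : 0 ≤ ∏ m ∈ Finset.range N, (1 - β m)⁻¹ :=
        Finset.prod_nonneg fun m _ => inv_nonneg.2 (by linarith [h1 m])
      positivity
    have hterm : ∀ (k : ℕ) x, (l.map fun m => ‖circlePowerSum x m‖ ^ 2).prod *
        vandermondeWeight x * E x *
        ((b * ‖circlePowerSum x (N + 1)‖ ^ 2 / (N + 1 : ℕ)) ^ k / k.factorial) =
        b ^ k / ((N + 1 : ℕ) ^ k * k.factorial) *
          ((((List.replicate k (N + 1) ++ l).map fun m => ‖circlePowerSum x m‖ ^ 2).prod *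
            vandermondeWeight x) * E x) := by
      intro k x
      simp only [List.map_append, List.map_replicate, List.prod_append, List.prod_replicate,
        div_pow, mul_pow]
      field_simp
    have hexp : ∀ x, ENNReal.ofReal ((l.map fun m => ‖circlePowerSum x m‖ ^ 2).prod *
        vandermondeWeight x * ∏ m ∈ Finset.range (N + 1),
          Real.exp (β m * ‖circlePowerSum x (m + 1)‖ ^ 2 / (m + 1 : ℕ))) =
        ∑' k : ℕ, ENNReal.ofReal (b ^ k / ((N + 1 : ℕ) ^ k * k.factorial)) * ENNReal.ofReal
          ((((List.replicate k (N + 1) ++ l).map fun m => ‖circlePowerSum x m‖ ^ 2).prod *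
            vandermondeWeight x) * E x) := by
      intro x
      rw [Finset.prod_range_succ, ← mul_assoc]
      set t := b * ‖circlePowerSum x (N + 1)‖ ^ 2 / (N + 1 : ℕ) with ht
      have ht0 : 0 ≤ t := by have := h0 N; positivity
      have hs : HasSum (fun k : ℕ => t ^ k / k.factorial) (Real.exp t) := by
        rw [Real.exp_eq_exp_ℝ]; exact NormedSpace.expSeries_div_hasSum_exp t
      have hs' := hs.mul_left ((l.map fun m => ‖circlePowerSum x m‖ ^ 2).prod *
        vandermondeWeight x * E x)
      rw [← hs'.tsum_eq, ENNReal.ofReal_tsum_of_nonneg _ hs'.summable]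
      · refine tsum_congr fun k => ?_
        rw [← ENNReal.ofReal_mul (by have := h0 N; positivity), ← hterm k x]
      · intro k
        have := prod_norm_sq_nonneg x l
        have := vandermondeWeight_nonneg x
        have := hE0 x
        positivity
    have hmeas : ∀ k : ℕ, Measurable fun x : Fin n → UnitAddCircle => ENNReal.ofReal
          ((((List.replicate k (N + 1) ++ l).map fun m => ‖circlePowerSum x m‖ ^ 2).prod *
            vandermondeWeight x) * E x) := by
      intro k
      refine ENNReal.measurable_ofReal.comp (Continuous.measurable ?_)
      simp only [hE, ← Laurent.norm_eval_powerProd_sq]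
      have h1 := Laurent.continuous_eval (Laurent.powerProd n (List.replicate k (N + 1) ++ l))
      have h2 := fun m => continuous_circlePowerSum (n := n) m
      fun_prop
    simp only [hexp]
    rw [lintegral_tsum fun k => ((hmeas k).const_mul _).aemeasurable]
    calc _ ≤ ∑' k : ℕ, ENNReal.ofReal (R * b ^ k) := by
          refine ENNReal.tsum_le_tsum fun k => ?_
          rw [lintegral_const_mul _ (hmeas k)]
          have hpos : 0 ≤ b ^ k / ((N + 1 : ℕ) ^ k * k.factorial) := by
            have := h0 N; positivity
          refine (mul_le_mul_right (ih (List.replicate k (N + 1) ++ l) ?_) _).trans_eq ?_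
          · intro j hj
            rcases List.mem_append.1 hj with hj | hj
            · rw [List.eq_of_mem_replicate hj]; omega
            · have := hl j hj; omega
          · rw [← ENNReal.ofReal_mul hpos, Laurent.zee_replicate_append]
            · congr 1
              simp only [hR]
              push_cast
              have : ((N : ℝ) + 1) ≠ 0 := by positivity
              field_simp
            · intro h
              exact lt_irrefl _ (hl _ h)
      _ = ENNReal.ofReal (∑' k : ℕ, R * b ^ k) := by
          rw [ENNReal.ofReal_tsum_of_nonneg]
          · intro k; have := h0 N; positivity
          · exact (summable_geometric_of_lt_one (h0 _) (h1 _)).mul_left R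
      _ = _ := by
          rw [tsum_mul_left, tsum_geometric_of_lt_one (h0 _) (h1 _), Finset.prod_range_succ, hR]
          congr 1
          ring

/-- Exponential moments of the traces of a random unitary matrix are bounded uniformly in the
size of the matrix. -/
lemma lintegral_exp_powerSums_le (β : ℕ → ℝ) (h0 : ∀ m, 0 ≤ β m) {B : ℝ} (hB : B < 1)
    (h1 : ∀ m, β m ≤ B) (hs : Summable β) (N : ℕ) :
    ∫⁻ x, ENNReal.ofReal (vandermondeWeight x * Real.exp (∑ m ∈ Finset.range N,
        β m * ‖circlePowerSum x (m + 1)‖ ^ 2 / (m + 1 : ℕ))) ∂(torusHaar n) ≤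
    ENNReal.ofReal (n.factorial * Real.exp ((1 - B)⁻¹ * ∑' m, β m)) := by
  have h := lintegral_powerSums_mul_exp_le (n := n) β h0 (fun m => (h1 m).trans_lt hB) N [] (by simp)
  simp only [List.map_nil, List.prod_nil, one_mul, Laurent.zee, Nat.cast_one, mul_one] at h
  simp only [Real.exp_sum]
  refine h.trans (ENNReal.ofReal_le_ofReal (mul_le_mul_of_nonneg_left ?_ (by positivity)))
  calc ∏ m ∈ Finset.range N, (1 - β m)⁻¹
      ≤ ∏ m ∈ Finset.range N, Real.exp ((1 - B)⁻¹ * β m) := by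
        refine Finset.prod_le_prod (fun m _ => inv_nonneg.2 (by linarith [h1 m])) ?_
        intro m _
        have hlt : 0 < 1 - β m := by linarith [h1 m]
        calc (1 - β m)⁻¹ = (1 - β m)⁻¹ * β m + 1 := by field_simp; ring
          _ ≤ (1 - B)⁻¹ * β m + 1 := by
            have := h0 m
            have := h1 m
            gcongr
          _ ≤ _ := Real.add_one_le_exp _
    _ = Real.exp (∑ m ∈ Finset.range N, (1 - B)⁻¹ * β m) := (Real.exp_sum _ _).symm
    _ ≤ _ := by
        rw [← Finset.mul_sum]
        have hB' : 0 ≤ (1 - B)⁻¹ := inv_nonneg.2 (by linarith)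
        gcongr
        exact hs.sum_le_tsum _ fun m _ => h0 m

/-- The bound for finite sums does not depend on `N`, so Fatou's lemma passes it to the limit. -/
lemma lintegral_exp_tsum_powerSums_le (β : ℕ → ℝ) (h0 : ∀ m, 0 ≤ β m) {B : ℝ} (hB : B < 1)
    (h1 : ∀ m, β m ≤ B) (hs : Summable β) :
    ∫⁻ x, ENNReal.ofReal (vandermondeWeight x * Real.exp (∑' m : ℕ,
        β m * ‖circlePowerSum x (m + 1)‖ ^ 2 / (m + 1 : ℕ))) ∂(torusHaar n) ≤
    ENNReal.ofReal (n.factorial * Real.exp ((1 - B)⁻¹ * ∑' m, β m)) := by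
  have hsum : ∀ x : Fin n → UnitAddCircle, Summable fun m : ℕ =>
      β m * ‖circlePowerSum x (m + 1)‖ ^ 2 / (m + 1 : ℕ) := by
    intro x
    refine Summable.of_nonneg_of_le (fun m => ?_) (fun m => ?_)
      (hs.mul_right ((n : ℝ) ^ 2))
    · have := h0 m; positivity
    · have hp : ‖circlePowerSum x (m + 1)‖ ≤ n := by
        refine (norm_sum_le _ _).trans ?_
        simp only [norm_pow, norm_fourier, one_pow]
        simp
      have := h0 m
      have h2 : β m * ‖circlePowerSum x (m + 1)‖ ^ 2 ≤ β m * (n : ℝ) ^ 2 := by gcongr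
      refine (div_le_self (by positivity) ?_).trans h2
      push_cast
      linarith [(Nat.cast_nonneg m : (0 : ℝ) ≤ m)]
  have hlim : ∀ x : Fin n → UnitAddCircle, Filter.Tendsto (fun N => ENNReal.ofReal
      (vandermondeWeight x * Real.exp (∑ m ∈ Finset.range N,
        β m * ‖circlePowerSum x (m + 1)‖ ^ 2 / (m + 1 : ℕ)))) Filter.atTop
      (nhds (ENNReal.ofReal (vandermondeWeight x * Real.exp (∑' m : ℕ,
        β m * ‖circlePowerSum x (m + 1)‖ ^ 2 / (m + 1 : ℕ))))) := fun x =>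
    ENNReal.tendsto_ofReal (((Real.continuous_exp.tendsto _).comp
      (hsum x).hasSum.tendsto_sum_nat).const_mul _)
  calc _ = ∫⁻ x, Filter.liminf (fun N => ENNReal.ofReal
      (vandermondeWeight x * Real.exp (∑ m ∈ Finset.range N,
        β m * ‖circlePowerSum x (m + 1)‖ ^ 2 / (m + 1 : ℕ)))) Filter.atTop ∂(torusHaar n) :=
        lintegral_congr fun x => (hlim x).liminf_eq.symm
    _ ≤ _ := lintegral_liminf_le fun N => by
        refine ENNReal.measurable_ofReal.comp (Continuous.measurable ?_)
        have h2 := fun m => continuous_circlePowerSum (n := n) m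
        have h3 := continuous_vandermondeWeight (n := n)
        fun_prop
    _ ≤ Filter.liminf (fun _ => ENNReal.ofReal
          (n.factorial * Real.exp ((1 - B)⁻¹ * ∑' m, β m))) Filter.atTop :=
        Filter.liminf_le_liminf (Filter.Eventually.of_forall fun N =>
          lintegral_exp_powerSums_le β h0 hB h1 hs N)
    _ = _ := Filter.liminf_const _

end Nekrasov

/-! ### The interaction as a quadratic form in power sums -/

namespace Nekrasov

open MeasureTheory ComplexConjugate

lemma hasSum_re_pow_div (a : ℂ) (ha : ‖a‖ < 1) :
    HasSum (fun m : ℕ => (a ^ (m + 1)).re / (m + 1 : ℕ)) (-Real.log ‖1 - a‖) := by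
  have h := Complex.hasSum_re (Complex.hasSum_taylorSeries_neg_log ha)
  rw [← hasSum_nat_add_iff' 1] at h
  simpa [Complex.log_re, -Nat.cast_add, Complex.div_natCast_re] using h

variable {n : ℕ}

lemma norm_circlePowerSum_le (x : Fin n → UnitAddCircle) (m : ℕ) : ‖circlePowerSum x m‖ ≤ n := by
  refine (norm_sum_le _ _).trans ?_
  simp only [norm_pow, norm_fourier, one_pow]
  simp

lemma norm_fourier_mul_conj (x y : UnitAddCircle) :
    ‖(fourier 1 x : ℂ) * conj (fourier 1 y : ℂ)‖ = 1 := by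
  rw [norm_mul, RCLike.norm_conj, norm_fourier, norm_fourier, one_mul]

lemma fourier_mul_conj_self (x : UnitAddCircle) :
    (fourier 1 x : ℂ) * conj (fourier 1 x : ℂ) = 1 := by
  rw [Complex.mul_conj', norm_fourier]; simp

lemma norm_one_sub_pos {a y : ℂ} (ha : ‖a‖ < 1) (hy : ‖y‖ = 1) : 0 < ‖1 - a * y‖ := by
  rw [norm_pos_iff, sub_ne_zero]
  intro h
  have : ‖a * y‖ = 1 := by rw [← h]; simp
  rw [norm_mul, hy, mul_one] at this
  exact ha.ne this

/-- Summing the logarithmic series over all pairs, the diagonal included, produces the double sum `∑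
(x_k / x_j)^m = |P_m|²`. -/
lemma hasSum_pair (a : ℂ) (ha : ‖a‖ < 1) (x : Fin n → UnitAddCircle) :
    HasSum (fun m : ℕ => (a ^ (m + 1)).re * ‖circlePowerSum x (m + 1)‖ ^ 2 / (m + 1 : ℕ))
      (-∑ jk : Fin n × Fin n,
        Real.log ‖1 - a * ((fourier 1 (x jk.2) : ℂ) * conj (fourier 1 (x jk.1) : ℂ))‖) := by
  rw [← Finset.sum_neg_distrib]
  have h := hasSum_sum (s := (Finset.univ : Finset (Fin n × Fin n))) fun jk _ =>
    hasSum_re_pow_div (a * ((fourier 1 (x jk.2) : ℂ) * conj (fourier 1 (x jk.1) : ℂ)))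
      (by rw [norm_mul, norm_fourier_mul_conj, mul_one]; exact ha)
  convert h using 2 with m
  rw [← Finset.sum_div]
  congr 1
  rw [← Complex.re_sum, ← Complex.re_mul_ofReal]
  congr 1
  rw [Complex.ofReal_pow, ← Complex.mul_conj', circlePowerSum, map_sum, Finset.sum_mul_sum,
    ← Finset.univ_product_univ, Finset.sum_product_right, Finset.mul_sum]
  refine Finset.sum_congr rfl fun i _ => ?_
  rw [Finset.mul_sum]
  refine Finset.sum_congr rfl fun j _ => ?_
  rw [map_pow]
  ring

lemma sum_abs_log_le {κ : ℝ} (hκ : κ < 1) (a : ℂ) (ha : ‖a‖ ≤ κ) (x : Fin n → UnitAddCircle) :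
    |∑ j, Real.log ‖1 - a * (fourier 1 (x j) : ℂ)‖| ≤
      ∑' m : ℕ, κ ^ (m + 1) * ‖circlePowerSum x (m + 1)‖ / (m + 1 : ℕ) := by
  have hκ0 : 0 ≤ κ := (norm_nonneg a).trans ha
  have h := hasSum_sum (s := (Finset.univ : Finset (Fin n))) fun j _ =>
    hasSum_re_pow_div (a * (fourier 1 (x j) : ℂ))
      (by rw [norm_mul, norm_fourier, mul_one]; exact ha.trans_lt hκ)
  rw [Finset.sum_neg_distrib] at h
  rw [← abs_neg, ← h.tsum_eq]
  have hle : ∀ m : ℕ, ‖∑ j, ((a * (fourier 1 (x j) : ℂ)) ^ (m + 1)).re / (m + 1 : ℕ)‖ ≤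
      κ ^ (m + 1) * ‖circlePowerSum x (m + 1)‖ / (m + 1 : ℕ) := by
    intro m
    rw [← Finset.sum_div, norm_div, ← Complex.re_sum]
    simp only [mul_pow]
    rw [← Finset.mul_sum, Real.norm_natCast]
    gcongr
    refine (Complex.abs_re_le_norm _).trans ?_
    rw [norm_mul, norm_pow]
    exact mul_le_mul_of_nonneg_right (pow_le_pow_left₀ (norm_nonneg _) ha _) (norm_nonneg _)
  have hsum : Summable fun m : ℕ => κ ^ (m + 1) * ‖circlePowerSum x (m + 1)‖ / (m + 1 : ℕ) := by
    refine Summable.of_nonneg_of_le (fun m => by positivity) (fun m => ?_)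
      (((summable_geometric_of_lt_one hκ0 hκ).mul_left κ).mul_right (n : ℝ))
    have := norm_circlePowerSum_le x (m + 1)
    refine (div_le_self (by positivity) ?_).trans ?_
    · push_cast; linarith [(Nat.cast_nonneg m : (0 : ℝ) ≤ m)]
    · rw [pow_succ']; gcongr
  exact tsum_of_norm_bounded hsum.hasSum hle

lemma vandermondeWeight_eq_prod (x : Fin n → UnitAddCircle) :
    vandermondeWeight x = ∏ jk ∈ (Finset.univ : Finset (Fin n)).offDiag,
      ‖(fourier 1 (x jk.1) : ℂ) - fourier 1 (x jk.2)‖ := by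
  classical
  set f : Fin n × Fin n → ℝ := fun jk => ‖(fourier 1 (x jk.1) : ℂ) - fourier 1 (x jk.2)‖ with hf
  have h1 : ‖(Matrix.vandermonde fun i => (fourier 1 (x i) : ℂ)).det‖ =
      ∏ jk ∈ Finset.univ.filter (fun jk : Fin n × Fin n => jk.2 < jk.1), f jk := by
    rw [Matrix.det_vandermonde, norm_prod]
    simp only [norm_prod]
    rw [Finset.prod_sigma']
    refine Finset.prod_bij' (fun p _ => (p.2, p.1)) (fun p _ => ⟨p.2, p.1⟩) ?_ ?_ ?_ ?_ ?_ <;>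
      simp [hf]
  have h2 : ∏ jk ∈ Finset.univ.filter (fun jk : Fin n × Fin n => jk.2 < jk.1), f jk =
      ∏ jk ∈ Finset.univ.filter (fun jk : Fin n × Fin n => jk.1 < jk.2), f jk := by
    refine Finset.prod_bij' (fun p _ => p.swap) (fun p _ => p.swap) ?_ ?_ ?_ ?_ ?_ <;>
      simp [hf, norm_sub_rev]
  rw [vandermondeWeight, sq]
  conv_lhs => rw [h1]; arg 2; rw [h2]
  rw [← Finset.prod_union]
  · refine Finset.prod_congr ?_ fun _ _ => rfl
    ext ⟨j, k⟩
    simp only [Finset.mem_union, Finset.mem_filter, Finset.mem_univ, true_and, Finset.mem_offDiag]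
    omega
  · rw [Finset.disjoint_left]
    rintro ⟨j, k⟩ h h'
    simp at h h'
    omega

lemma prod_norm_pair (a : ℂ) (ha : ‖a‖ < 1) (x : Fin n → UnitAddCircle) :
    ∏ jk : Fin n × Fin n,
        ‖1 - a * ((fourier 1 (x jk.2) : ℂ) * conj (fourier 1 (x jk.1) : ℂ))‖ =
      Real.exp (-∑' m : ℕ, (a ^ (m + 1)).re * ‖circlePowerSum x (m + 1)‖ ^ 2 / (m + 1 : ℕ)) := by
  rw [(hasSum_pair a ha x).tsum_eq, neg_neg, Real.exp_sum]
  refine Finset.prod_congr rfl fun jk _ => ?_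
  rw [Real.exp_log (norm_one_sub_pos ha (norm_fourier_mul_conj _ _))]

/-- The exponents governing the interaction of the power sums. -/
noncomputable def interactionCoeff (q₁ q₂ : ℂ) (m : ℕ) : ℝ :=
  (q₁ ^ m + q₂ ^ m - (q₁ * q₂) ^ m).re

lemma norm_mul_lt_one {q₁ q₂ : ℂ} (h₁ : ‖q₁‖ < 1) (h₂ : ‖q₂‖ < 1) : ‖q₁ * q₂‖ < 1 := by
  rw [norm_mul]; exact mul_lt_one_of_nonneg_of_lt_one_left (norm_nonneg _) h₁ h₂.le

/-- The factors `z_j - z_k` give `vandermondeWeight`, the powers of `ρ` cancel, and the normalising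
constant is exactly the missing diagonal factor, where `x_k / x_j = 1`. -/
lemma prod_pair_eq {q₁ q₂ : ℂ} (h₁ : ‖q₁‖ < 1) (h₂ : ‖q₂‖ < 1) {ρ : ℝ} (hρ : 0 < ρ)
    (x : Fin n → UnitAddCircle) :
    ‖(1 - q₁ * q₂) / ((1 - q₁) * (1 - q₂))‖ ^ n *
      ‖∏ jk ∈ (Finset.univ : Finset (Fin n)).offDiag,
        ((ρ * (fourier 1 (x jk.1) : ℂ) - ρ * (fourier 1 (x jk.2) : ℂ)) *
          (ρ * (fourier 1 (x jk.1) : ℂ) - q₁ * q₂ * (ρ * (fourier 1 (x jk.2) : ℂ)))) /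
        ((ρ * (fourier 1 (x jk.1) : ℂ) - q₁ * (ρ * (fourier 1 (x jk.2) : ℂ))) *
          (ρ * (fourier 1 (x jk.1) : ℂ) - q₂ * (ρ * (fourier 1 (x jk.2) : ℂ))))‖ =
    vandermondeWeight x * Real.exp (∑' m : ℕ, interactionCoeff q₁ q₂ (m + 1) *
      ‖circlePowerSum x (m + 1)‖ ^ 2 / (m + 1 : ℕ)) := by
  classical
  set y : Fin n × Fin n → ℂ := fun jk =>
    (fourier 1 (x jk.2) : ℂ) * conj (fourier 1 (x jk.1) : ℂ) with hy
  have hy1 : ∀ jk, ‖y jk‖ = 1 := fun jk => norm_fourier_mul_conj _ _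
  have hq := norm_mul_lt_one h₁ h₂
  set h : Fin n × Fin n → ℝ := fun jk =>
    ‖1 - q₁ * q₂ * y jk‖ / (‖1 - q₁ * y jk‖ * ‖1 - q₂ * y jk‖) with hh
  have hz : ∀ (a : ℂ) jk, ‖ρ * (fourier 1 (x jk.1) : ℂ) - a * (ρ * (fourier 1 (x jk.2) : ℂ))‖ =
      ρ * ‖1 - a * y jk‖ := by
    intro a jk
    have : ρ * (fourier 1 (x jk.1) : ℂ) - a * (ρ * (fourier 1 (x jk.2) : ℂ)) =
        ρ * (fourier 1 (x jk.1) : ℂ) * (1 - a * y jk) := by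
      have := fourier_mul_conj_self (x jk.1)
      simp only [hy]
      linear_combination (a * ρ * (fourier 1 (x jk.2) : ℂ)) * this
    rw [this, norm_mul, norm_mul, norm_fourier, mul_one, Complex.norm_real, Real.norm_of_nonneg hρ.le]
  have hoff : ‖∏ jk ∈ (Finset.univ : Finset (Fin n)).offDiag,
        ((ρ * (fourier 1 (x jk.1) : ℂ) - ρ * (fourier 1 (x jk.2) : ℂ)) *
          (ρ * (fourier 1 (x jk.1) : ℂ) - q₁ * q₂ * (ρ * (fourier 1 (x jk.2) : ℂ)))) /
        ((ρ * (fourier 1 (x jk.1) : ℂ) - q₁ * (ρ * (fourier 1 (x jk.2) : ℂ))) *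
          (ρ * (fourier 1 (x jk.1) : ℂ) - q₂ * (ρ * (fourier 1 (x jk.2) : ℂ))))‖ =
      vandermondeWeight x * ∏ jk ∈ (Finset.univ : Finset (Fin n)).offDiag, h jk := by
    rw [vandermondeWeight_eq_prod, ← Finset.prod_mul_distrib, norm_prod]
    refine Finset.prod_congr rfl fun jk _ => ?_
    rw [norm_div, norm_mul, norm_mul, hz, hz, hz, ← mul_sub, norm_mul, Complex.norm_real,
      Real.norm_of_nonneg hρ.le, hh]
    have e1 := (norm_one_sub_pos h₁ (hy1 jk)).ne'
    have e2 := (norm_one_sub_pos h₂ (hy1 jk)).ne'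
    field_simp
  have hdiag : ‖(1 - q₁ * q₂) / ((1 - q₁) * (1 - q₂))‖ ^ n =
      ∏ jk ∈ (Finset.univ : Finset (Fin n)).diag, h jk := by
    have : ∀ jk ∈ (Finset.univ : Finset (Fin n)).diag,
        h jk = ‖(1 - q₁ * q₂) / ((1 - q₁) * (1 - q₂))‖ := by
      rintro ⟨j, k⟩ hjk
      have : j = k := by simpa using hjk
      subst this
      simp only [hh, hy, fourier_mul_conj_self, mul_one, norm_div, norm_mul]
    rw [Finset.prod_congr rfl this, Finset.prod_const, Finset.diag_card, Finset.card_univ,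
      Fintype.card_fin]
  have hall : ∏ jk, h jk = Real.exp (∑' m : ℕ, interactionCoeff q₁ q₂ (m + 1) *
      ‖circlePowerSum x (m + 1)‖ ^ 2 / (m + 1 : ℕ)) := by
    have hs := ((hasSum_pair q₁ h₁ x).add (hasSum_pair q₂ h₂ x)).sub (hasSum_pair _ hq x)
    simp only [hh, Finset.prod_div_distrib, Finset.prod_mul_distrib]
    rw [prod_norm_pair _ h₁, prod_norm_pair _ h₂, prod_norm_pair _ hq, ← Real.exp_add,
      ← Real.exp_sub]
    congr 1
    rw [(hasSum_pair q₁ h₁ x).tsum_eq, (hasSum_pair q₂ h₂ x).tsum_eq, (hasSum_pair _ hq x).tsum_eq]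
    have hfun : ∀ m : ℕ, interactionCoeff q₁ q₂ (m + 1) *
        ‖circlePowerSum x (m + 1)‖ ^ 2 / (m + 1 : ℕ) =
        (q₁ ^ (m + 1)).re * ‖circlePowerSum x (m + 1)‖ ^ 2 / (m + 1 : ℕ) +
          (q₂ ^ (m + 1)).re * ‖circlePowerSum x (m + 1)‖ ^ 2 / (m + 1 : ℕ) -
        ((q₁ * q₂) ^ (m + 1)).re * ‖circlePowerSum x (m + 1)‖ ^ 2 / (m + 1 : ℕ) := by
      intro m
      simp only [interactionCoeff, Complex.sub_re, Complex.add_re]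
      ring
    rw [tsum_congr hfun, hs.tsum_eq]
    ring
  rw [hoff, mul_left_comm, hdiag, ← Finset.prod_union (Finset.disjoint_diag_offDiag _),
    Finset.diag_union_offDiag, Finset.univ_product_univ, hall]

/-- The gap `1 - c_m` is `|1 - q₂^m|²` for conjugate parameters and a product of two positive
numbers for real ones. -/
lemma interactionCoeff_lt_one {q₁ q₂ : ℂ} (h₁ : ‖q₁‖ < 1) (h₂ : ‖q₂‖ < 1)
    (hq : q₁ = conj q₂ ∨
      ∃ x₁ ∈ Set.Ioo (0 : ℝ) 1, ∃ x₂ ∈ Set.Ioo (0 : ℝ) 1, q₁ = (x₁ : ℂ) ∧ q₂ = (x₂ : ℂ)) (m : ℕ) :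
    interactionCoeff q₁ q₂ (m + 1) < 1 := by
  have key : 1 - interactionCoeff q₁ q₂ (m + 1) = ((1 - q₁ ^ (m + 1)) * (1 - q₂ ^ (m + 1))).re := by
    rw [interactionCoeff, ← Complex.one_re, ← Complex.sub_re, mul_pow]
    congr 1
    ring
  have hpos : 0 < ((1 - q₁ ^ (m + 1)) * (1 - q₂ ^ (m + 1))).re := by
    rcases hq with rfl | ⟨x₁, hx₁, x₂, hx₂, rfl, rfl⟩
    · rw [← map_pow, ← map_one (starRingEnd ℂ), ← map_sub, mul_comm, map_one, Complex.mul_conj']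
      norm_cast
      have : 1 - q₂ ^ (m + 1) ≠ 0 := by
        rw [sub_ne_zero]
        intro h
        have h3 : ‖q₂ ^ (m + 1)‖ < 1 := by
          rw [norm_pow]; exact pow_lt_one₀ (norm_nonneg _) h₂ (by omega)
        rw [← h] at h3
        simp at h3
      positivity
    · have e1 : x₁ ^ (m + 1) < 1 := pow_lt_one₀ hx₁.1.le hx₁.2 (by omega)
      have e2 : x₂ ^ (m + 1) < 1 := pow_lt_one₀ hx₂.1.le hx₂.2 (by omega)
      norm_cast
      exact mul_pos (by linarith) (by linarith)
  linarith

lemma abs_interactionCoeff_le {q₁ q₂ : ℂ} {κ : ℝ} (hκ : κ ≤ 1) (h₁ : ‖q₁‖ ≤ κ) (h₂ : ‖q₂‖ ≤ κ)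
    (m : ℕ) : |interactionCoeff q₁ q₂ m| ≤ 3 * κ ^ m := by
  refine (Complex.abs_re_le_norm _).trans ?_
  have e1 : ‖q₁ ^ m‖ ≤ κ ^ m := by rw [norm_pow]; gcongr
  have e2 : ‖q₂ ^ m‖ ≤ κ ^ m := by rw [norm_pow]; gcongr
  have e3 : ‖(q₁ * q₂) ^ m‖ ≤ κ ^ m := by
    rw [norm_pow, norm_mul]
    gcongr
    calc ‖q₁‖ * ‖q₂‖ ≤ ‖q₁‖ * 1 := by gcongr; exact h₂.trans hκ
      _ ≤ κ := by rwa [mul_one]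
  refine (norm_sub_le _ _).trans ?_
  have := norm_add_le (q₁ ^ m) (q₂ ^ m)
  linarith

end Nekrasov

/-! ### One-body factors and their absorption into the quadratic form -/

namespace Nekrasov

open MeasureTheory ComplexConjugate Filter Topology

variable {n : ℕ}

/-- The majorant of the linear statistics of `1 - a w` for `‖a‖ ≤ κ`. -/
noncomputable def logMajorant (κ : ℝ) (x : Fin n → UnitAddCircle) : ℝ :=
  ∑' m : ℕ, κ ^ (m + 1) * ‖circlePowerSum x (m + 1)‖ / (m + 1 : ℕ)

lemma prod_norm_one_sub_le {κ : ℝ} (hκ : κ < 1) {a : ℂ} (ha : ‖a‖ ≤ κ)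
    (x : Fin n → UnitAddCircle) :
    ∏ j, ‖1 - a * (fourier 1 (x j) : ℂ)‖ ≤ Real.exp (logMajorant κ x) ∧
      (∏ j, ‖1 - a * (fourier 1 (x j) : ℂ)‖)⁻¹ ≤ Real.exp (logMajorant κ x) := by
  have h := abs_le.1 (sum_abs_log_le hκ a ha x)
  have e : ∏ j, ‖1 - a * (fourier 1 (x j) : ℂ)‖ =
      Real.exp (∑ j, Real.log ‖1 - a * (fourier 1 (x j) : ℂ)‖) := by
    rw [Real.exp_sum]
    exact Finset.prod_congr rfl fun j _ =>
      (Real.exp_log (norm_one_sub_pos (ha.trans_lt hκ) (norm_fourier _ _))).symm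
  rw [e, ← Real.exp_neg]
  unfold logMajorant
  exact ⟨Real.exp_le_exp.2 h.2, Real.exp_le_exp.2 (by linarith [h.1])⟩

/-- On the circle the larger of `|p|` and `ρ` is factored out; when that is `ρ`, conjugation turns
`1 - p / (ρ w)` into `1 - conj p / ρ * w`. -/
lemma exists_norm_sub_eq {ρ : ℝ} (hρ : 0 < ρ) (p : ℂ) (hp : ‖p‖ ≠ ρ) :
    ∃ a : ℂ, ‖a‖ < 1 ∧ ∀ x : UnitAddCircle,
      ‖ρ * (fourier 1 x : ℂ) - p‖ = max ‖p‖ ρ * ‖1 - a * (fourier 1 x : ℂ)‖ := by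
  rcases hp.lt_or_gt with h | h
  · refine ⟨conj p / ρ, ?_, fun x => ?_⟩
    · rw [norm_div, RCLike.norm_conj, Complex.norm_real, Real.norm_of_nonneg hρ.le, div_lt_one hρ]
      exact h
    · have hρ' : (ρ : ℂ) ≠ 0 := by exact_mod_cast hρ.ne'
      have : conj (ρ * (fourier 1 x : ℂ) - p) =
          ρ * conj (fourier 1 x : ℂ) * (1 - conj p / ρ * (fourier 1 x : ℂ)) := by
        have := fourier_mul_conj_self x
        rw [map_sub, map_mul, Complex.conj_ofReal]
        field_simp
        linear_combination (conj p) * this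
      rw [← RCLike.norm_conj, this, norm_mul, norm_mul, RCLike.norm_conj, norm_fourier, mul_one,
        Complex.norm_real, Real.norm_of_nonneg hρ.le, max_eq_right h.le]
  · have hp0 : p ≠ 0 := norm_pos_iff.1 (hρ.trans h)
    refine ⟨ρ / p, ?_, fun x => ?_⟩
    · rw [norm_div, Complex.norm_real, Real.norm_of_nonneg hρ.le, div_lt_one (hρ.trans h)]
      exact h
    · have : ρ * (fourier 1 x : ℂ) - p = -p * (1 - ρ / p * (fourier 1 x : ℂ)) := by
        field_simp
        ring
      rw [this, norm_mul, norm_neg, max_eq_left h.le]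

/-- The one-body factor of the integrand. -/
noncomputable def potential {r s : ℕ} (q : ℂ) (u : Fin r → ℂ) (p : Fin s → ℂ) (z : ℂ) : ℂ :=
  (∏ m, (z - p m)) * ∏ α, (-u α * z) / ((z - u α) * (q * z - u α))

/-- The two extracted constants `ρ` and `|u|` cancel the numerator, so the `u_α` contribute nothing
to the exponential growth rate. -/
lemma exists_norm_potential_factor {ρ : ℝ} (hρ : 0 < ρ) {q u : ℂ} (hu : ‖u‖ < ρ)
    (hq : ‖q‖ * ρ < ‖u‖) :
    ∃ a b : ℂ, ‖a‖ < 1 ∧ ‖b‖ < 1 ∧ ∀ x : UnitAddCircle,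
      ‖(-u * (ρ * (fourier 1 x : ℂ))) /
        ((ρ * (fourier 1 x : ℂ) - u) * (q * (ρ * (fourier 1 x : ℂ)) - u))‖ =
        (‖1 - a * (fourier 1 x : ℂ)‖)⁻¹ * (‖1 - b * (fourier 1 x : ℂ)‖)⁻¹ := by
  obtain ⟨a, ha, ha'⟩ := exists_norm_sub_eq hρ u hu.ne
  have hu0 : 0 < ‖u‖ := (by positivity : 0 ≤ ‖q‖ * ρ).trans_lt hq
  refine ⟨a, q * ρ / u, ha, ?_, fun x => ?_⟩
  · rw [norm_div, norm_mul, Complex.norm_real, Real.norm_of_nonneg hρ.le, div_lt_one hu0]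
    exact hq
  · have hu1 : u ≠ 0 := norm_pos_iff.1 hu0
    have : q * (ρ * (fourier 1 x : ℂ)) - u = -u * (1 - q * ρ / u * (fourier 1 x : ℂ)) := by
      field_simp
      ring
    rw [norm_div, norm_mul, norm_mul, norm_mul, ha', this, norm_mul, norm_fourier,
      Complex.norm_real, Real.norm_of_nonneg hρ.le, max_eq_right hu.le, norm_neg]
    rw [div_eq_mul_inv, mul_inv, mul_inv, mul_inv]
    field_simp

/-- Finitely many numbers `a` with `|a| < 1` occur, so any `κ` close to `1` dominates them all;
there are `s` factors from `p` and two for each `u α`. -/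
lemma eventually_prod_norm_potential_le {r s : ℕ} {q : ℂ} {u : Fin r → ℂ} {p : Fin s → ℂ}
    {ρ : ℝ} (hρ : 0 < ρ) (hu : ∀ α, ‖u α‖ < ρ) (hq : ∀ α, ‖q‖ * ρ < ‖u α‖)
    (hp : ∀ m, ‖p m‖ ≠ ρ) :
    ∀ᶠ κ in 𝓝[<] (1 : ℝ), ∀ (n : ℕ) (x : Fin n → UnitAddCircle),
      ∏ j, ‖potential q u p (ρ * (fourier 1 (x j) : ℂ))‖ ≤
        (∏ m, max ‖p m‖ ρ) ^ n * Real.exp ((s + 2 * r : ℕ) * logMajorant κ x) := by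
  choose c hc hc' using fun m => exists_norm_sub_eq hρ (p m) (hp m)
  choose a b ha hb hab using fun α => exists_norm_potential_factor hρ (hu α) (hq α)
  have ev : ∀ y : ℂ, ‖y‖ < 1 → ∀ᶠ κ in 𝓝[<] (1 : ℝ), ‖y‖ ≤ κ := fun y hy =>
    (eventually_ge_nhds hy).filter_mono nhdsWithin_le_nhds
  filter_upwards [eventually_all.2 fun m => ev _ (hc m), eventually_all.2 fun α => ev _ (ha α),
    eventually_all.2 fun α => ev _ (hb α), self_mem_nhdsWithin] with κ h1 h2 h3 h4 n x
  have hfac : ∏ j, ‖potential q u p (ρ * (fourier 1 (x j) : ℂ))‖ =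
      (∏ m, max ‖p m‖ ρ) ^ n * ((∏ m, ∏ j, ‖1 - c m * (fourier 1 (x j) : ℂ)‖) *
        ∏ α, ((∏ j, ‖1 - a α * (fourier 1 (x j) : ℂ)‖)⁻¹ *
          (∏ j, ‖1 - b α * (fourier 1 (x j) : ℂ)‖)⁻¹)) := by
    simp only [potential, norm_mul, norm_prod, hc', hab, Finset.prod_mul_distrib]
    rw [Finset.prod_const, Finset.card_univ, Fintype.card_fin, Finset.prod_comm, mul_assoc]
    congr 3
    · rw [Finset.prod_comm]
      simp only [Finset.prod_inv_distrib]
    · rw [Finset.prod_comm]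
      simp only [Finset.prod_inv_distrib]
  rw [hfac]
  have hP : 0 ≤ ∏ m, max ‖p m‖ ρ := Finset.prod_nonneg fun m _ => hρ.le.trans (le_max_right _ _)
  refine mul_le_mul_of_nonneg_left ?_ (pow_nonneg hP n)
  set E := Real.exp (logMajorant κ x) with hE
  calc _ ≤ (∏ _m : Fin s, E) * ∏ _α : Fin r, (E * E) := by
        gcongr with m _ α _
        · exact (prod_norm_one_sub_le h4 (h1 m) x).1
        · exact (prod_norm_one_sub_le h4 (h2 α) x).2
        · exact (prod_norm_one_sub_le h4 (h3 α) x).2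
    _ = Real.exp ((s + 2 * r : ℕ) * logMajorant κ x) := by
        rw [Finset.prod_const, Finset.prod_const, Finset.card_univ, Finset.card_univ,
          Fintype.card_fin, Fintype.card_fin, Real.exp_nat_mul, ← hE]
        ring

lemma summable_of_le_geometric {κ : ℝ} (hκ0 : 0 ≤ κ) (hκ : κ < 1) {f : ℕ → ℝ} (D : ℝ)
    (hf : ∀ m, |f m| ≤ D * κ ^ (m + 1)) : Summable f :=
  Summable.of_norm_bounded
    (((summable_nat_add_iff 1).2 (summable_geometric_of_lt_one hκ0 hκ)).mul_left D) hf

/-- The sequence tends to `0`, so only finitely many terms exceed `1 / 2`, and each of those is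
below `1`. -/
lemma exists_bound_of_lt_one {κ : ℝ} (hκ0 : 0 ≤ κ) (hκ : κ < 1) {b : ℕ → ℝ} (D : ℝ)
    (hb : ∀ m, |b m| ≤ D * κ ^ (m + 1)) (h1 : ∀ m, b m < 1) :
    ∃ B, 0 < B ∧ B < 1 ∧ ∀ m, b m ≤ B := by
  have hlim := (summable_of_le_geometric hκ0 hκ D hb).tendsto_atTop_zero
  obtain ⟨M, hM⟩ := eventually_atTop.1 (hlim.eventually (eventually_le_nhds one_half_pos))
  have ev : ∀ᶠ B in 𝓝[<] (1 : ℝ), ∀ m ∈ Finset.range M, b m ≤ B :=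
    (Finset.eventually_all _).2 fun m _ =>
      (eventually_ge_nhds (h1 m)).filter_mono nhdsWithin_le_nhds
  have ev2 : ∀ᶠ B in 𝓝[<] (1 : ℝ), 1 / 2 ≤ B :=
    (eventually_ge_nhds one_half_lt_one).filter_mono nhdsWithin_le_nhds
  obtain ⟨B, hB1, hB2, hB3⟩ := (ev.and (ev2.and self_mem_nhdsWithin)).exists
  refine ⟨B, by linarith, hB3, fun m => ?_⟩
  by_cases hm : m < M
  · exact hB1 m (Finset.mem_range.2 hm)
  · exact (hM m (not_lt.1 hm)).trans hB2

/-- Termwise Young inequality `c P ≤ δ P² + c² / (4δ)`: the linear term costs an arbitrarily small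
increase of the quadratic coefficient and a constant independent of `n` and `x`. Truncation at `0`
makes the new coefficients nonnegative. -/
lemma tsum_add_le {κ δ c : ℝ} (hκ0 : 0 ≤ κ) (hκ : κ < 1) (hδ : 0 < δ)
    {b : ℕ → ℝ} (D : ℝ) (hb : ∀ m, |b m| ≤ D * κ ^ (m + 1)) (x : Fin n → UnitAddCircle) :
    ∑' m : ℕ, b m * ‖circlePowerSum x (m + 1)‖ ^ 2 / (m + 1 : ℕ) + c * logMajorant κ x ≤
      ∑' m : ℕ, (max (b m) 0 + δ * κ ^ (m + 1)) * ‖circlePowerSum x (m + 1)‖ ^ 2 / (m + 1 : ℕ) +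
        ∑' m : ℕ, c ^ 2 / (4 * δ) * κ ^ (m + 1) := by
  have hm1 : ∀ m : ℕ, (1 : ℝ) ≤ (m + 1 : ℕ) := fun m => by
    push_cast; linarith [(Nat.cast_nonneg m : (0 : ℝ) ≤ m)]
  have hD : 0 ≤ D * κ := by simpa using (abs_nonneg _).trans (hb 0)
  have hmax : ∀ m, |max (b m) 0| ≤ D * κ ^ (m + 1) := fun m => by
    rw [abs_of_nonneg (le_max_right _ _)]
    refine max_le ((le_abs_self _).trans (hb m)) ((abs_nonneg _).trans (hb m))
  have hgen : ∀ (f : ℕ → ℝ) (D' : ℝ), (∀ m, |f m| ≤ D' * κ ^ (m + 1)) →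
      Summable fun m : ℕ => f m * ‖circlePowerSum x (m + 1)‖ ^ 2 / (m + 1 : ℕ) := by
    intro f D' hf
    refine summable_of_le_geometric hκ0 hκ (D' * n ^ 2) fun m => ?_
    have hp := norm_circlePowerSum_le x (m + 1)
    rw [abs_div, abs_mul, abs_of_nonneg (by positivity : 0 ≤ ‖circlePowerSum x (m + 1)‖ ^ 2),
      Nat.abs_cast]
    refine (div_le_self (by positivity) (hm1 m)).trans ?_
    calc _ ≤ D' * κ ^ (m + 1) * n ^ 2 := by
          refine mul_le_mul (hf m) (by gcongr) (by positivity) ((abs_nonneg _).trans (hf m))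
      _ = _ := by ring
  have hs1 := hgen b D hb
  have hs2 := hgen (fun m => max (b m) 0 + δ * κ ^ (m + 1)) (D + δ) fun m => by
    refine (abs_add_le _ _).trans ?_
    rw [add_mul, abs_of_nonneg (by positivity : 0 ≤ δ * κ ^ (m + 1))]
    linarith [hmax m]
  have hs3 : Summable fun m : ℕ => κ ^ (m + 1) * ‖circlePowerSum x (m + 1)‖ / (m + 1 : ℕ) := by
    refine summable_of_le_geometric hκ0 hκ n fun m => ?_
    have hp := norm_circlePowerSum_le x (m + 1)
    rw [abs_of_nonneg (by positivity), mul_comm (n : ℝ)]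
    refine (div_le_self (by positivity) (hm1 m)).trans (by gcongr)
  have hs4 : Summable fun m : ℕ => c ^ 2 / (4 * δ) * κ ^ (m + 1) :=
    ((summable_nat_add_iff 1).2 (summable_geometric_of_lt_one hκ0 hκ)).mul_left _
  rw [logMajorant, ← tsum_mul_left, ← hs1.tsum_add (hs3.mul_left c), ← hs2.tsum_add hs4]
  refine (hs1.add (hs3.mul_left c)).tsum_le_tsum (fun m => ?_) (hs2.add hs4)
  set P := ‖circlePowerSum x (m + 1)‖ with hP
  set k : ℝ := ((m + 1 : ℕ) : ℝ) with hk
  have hk1 : 1 ≤ k := hm1 m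
  have hK : 0 ≤ κ ^ (m + 1) := by positivity
  have e1 : c * P ≤ δ * P ^ 2 + c ^ 2 / (4 * δ) := by
    have : δ * P ^ 2 + c ^ 2 / (4 * δ) - c * P = (2 * δ * P - c) ^ 2 / (4 * δ) := by
      field_simp; ring
    have h2 : 0 ≤ (2 * δ * P - c) ^ 2 / (4 * δ) := by positivity
    linarith
  have e2 : b m * P ^ 2 ≤ max (b m) 0 * P ^ 2 := by gcongr; exact le_max_left _ _
  calc b m * P ^ 2 / k + c * (κ ^ (m + 1) * P / k)
      = (b m * P ^ 2 + κ ^ (m + 1) * (c * P)) / k := by ring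
    _ ≤ (max (b m) 0 * P ^ 2 + κ ^ (m + 1) * (δ * P ^ 2 + c ^ 2 / (4 * δ))) / k := by gcongr
    _ = (max (b m) 0 + δ * κ ^ (m + 1)) * P ^ 2 / k + c ^ 2 / (4 * δ) * κ ^ (m + 1) / k := by ring
    _ ≤ _ := by
        have : c ^ 2 / (4 * δ) * κ ^ (m + 1) / k ≤ c ^ 2 / (4 * δ) * κ ^ (m + 1) :=
          div_le_self (by positivity) hk1
        linarith

/-- The integral of the modulus of the integrand over the torus, including the normalisation,
grows at most like `n!` times the geometric mean of the potential. -/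
lemma exists_lintegral_integrand_le {r s : ℕ} {q₁ q₂ : ℂ} (h₁ : ‖q₁‖ < 1) (h₂ : ‖q₂‖ < 1)
    (hq : q₁ = conj q₂ ∨
      ∃ x₁ ∈ Set.Ioo (0 : ℝ) 1, ∃ x₂ ∈ Set.Ioo (0 : ℝ) 1, q₁ = (x₁ : ℂ) ∧ q₂ = (x₂ : ℂ))
    {u : Fin r → ℂ} {p : Fin s → ℂ} {ρ : ℝ} (hρ : 0 < ρ) (hu : ∀ α, ‖u α‖ < ρ)
    (hqu : ∀ α, ‖q₁ * q₂‖ * ρ < ‖u α‖) (hp : ∀ m, ‖p m‖ ≠ ρ) :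
    ∃ C : ℝ, 0 < C ∧ ∀ n : ℕ, ∫⁻ x, ENNReal.ofReal
      (‖(1 - q₁ * q₂) / ((1 - q₁) * (1 - q₂))‖ ^ n *
        ‖(∏ j, ∏ m, (ρ * (fourier 1 (x j) : ℂ) - p m)) *
          integrand q₁ q₂ u fun j => ρ * (fourier 1 (x j) : ℂ)‖) ∂(torusHaar n) ≤
      ENNReal.ofReal (n.factorial * (C * (∏ m, max ‖p m‖ ρ) ^ n)) := by
  have ev : ∀ y : ℂ, ‖y‖ < 1 → ∀ᶠ κ in 𝓝[<] (1 : ℝ), ‖y‖ ≤ κ := fun y hy =>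
    (eventually_ge_nhds hy).filter_mono nhdsWithin_le_nhds
  obtain ⟨κ, hκpot, hκ₁, hκ₂, hκ⟩ := ((eventually_prod_norm_potential_le hρ hu hqu hp).and
    ((ev _ h₁).and ((ev _ h₂).and self_mem_nhdsWithin))).exists
  replace hκ : κ < 1 := hκ
  have hκ0 : 0 ≤ κ := (norm_nonneg _).trans hκ₁
  set b : ℕ → ℝ := fun m => interactionCoeff q₁ q₂ (m + 1) with hb
  have hb3 : ∀ m, |b m| ≤ 3 * κ ^ (m + 1) := fun m => abs_interactionCoeff_le hκ.le hκ₁ hκ₂ _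
  obtain ⟨B, hB0, hB1, hB⟩ := exists_bound_of_lt_one hκ0 hκ 3 hb3
    (interactionCoeff_lt_one h₁ h₂ hq)
  -- Half of the gap below `1`, so that `B + δ < 1` still holds.
  set δ := (1 - B) / 2 with hδ
  have hδ0 : 0 < δ := by rw [hδ]; linarith
  set c : ℝ := ((s + 2 * r : ℕ) : ℝ) with hc
  set β : ℕ → ℝ := fun m => max (b m) 0 + δ * κ ^ (m + 1) with hβ
  have hβ0 : ∀ m, 0 ≤ β m := fun m => add_nonneg (le_max_right _ _) (by positivity)
  have hβ1 : ∀ m, β m ≤ B + δ := fun m => by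
    refine add_le_add (max_le (hB m) hB0.le) ?_
    exact mul_le_of_le_one_right hδ0.le (pow_le_one₀ hκ0 hκ.le)
  have hβs : Summable β := by
    refine summable_of_le_geometric hκ0 hκ (3 + δ) fun m => ?_
    rw [abs_of_nonneg (hβ0 m), add_mul]
    exact add_le_add (max_le ((le_abs_self _).trans (hb3 m)) (by positivity)) le_rfl
  set K : ℝ := ∑' m : ℕ, c ^ 2 / (4 * δ) * κ ^ (m + 1) with hK
  set P : ℝ := ∏ m, max ‖p m‖ ρ with hP
  have hP0 : 0 ≤ P := Finset.prod_nonneg fun m _ => hρ.le.trans (le_max_right _ _)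
  refine ⟨Real.exp K * Real.exp ((1 - (B + δ))⁻¹ * ∑' m, β m), by positivity, fun n => ?_⟩
  have hpt : ∀ x : Fin n → UnitAddCircle, ‖(1 - q₁ * q₂) / ((1 - q₁) * (1 - q₂))‖ ^ n *
        ‖(∏ j, ∏ m, (ρ * (fourier 1 (x j) : ℂ) - p m)) *
          integrand q₁ q₂ u fun j => ρ * (fourier 1 (x j) : ℂ)‖ ≤
      P ^ n * Real.exp K * (vandermondeWeight x * Real.exp (∑' m : ℕ,
        β m * ‖circlePowerSum x (m + 1)‖ ^ 2 / (m + 1 : ℕ))) := by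
    intro x
    have hV := vandermondeWeight_nonneg x
    rw [integrand, ← mul_assoc (∏ j, ∏ m, (ρ * (fourier 1 (x j) : ℂ) - p m)),
      ← Finset.prod_mul_distrib, norm_mul, mul_left_comm, prod_pair_eq h₁ h₂ hρ, norm_prod]
    calc _ ≤ P ^ n * Real.exp (c * logMajorant κ x) * (vandermondeWeight x *
          Real.exp (∑' m : ℕ, b m * ‖circlePowerSum x (m + 1)‖ ^ 2 / (m + 1 : ℕ))) := by
          refine mul_le_mul_of_nonneg_right (hκpot n x) (by positivity)
      _ = P ^ n * (vandermondeWeight x * Real.exp (∑' m : ℕ,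
            b m * ‖circlePowerSum x (m + 1)‖ ^ 2 / (m + 1 : ℕ) + c * logMajorant κ x)) := by
          rw [Real.exp_add]; ring
      _ ≤ P ^ n * (vandermondeWeight x * Real.exp (∑' m : ℕ,
            β m * ‖circlePowerSum x (m + 1)‖ ^ 2 / (m + 1 : ℕ) + K)) := by
          exact mul_le_mul_of_nonneg_left (mul_le_mul_of_nonneg_left
            (Real.exp_le_exp.2 (tsum_add_le hκ0 hκ hδ0 3 hb3 x)) hV) (pow_nonneg hP0 n)
      _ = _ := by rw [Real.exp_add]; ring
  calc _ ≤ ∫⁻ x, ENNReal.ofReal (P ^ n * Real.exp K) * ENNReal.ofReal (vandermondeWeight x *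
          Real.exp (∑' m : ℕ, β m * ‖circlePowerSum x (m + 1)‖ ^ 2 / (m + 1 : ℕ)))
          ∂(torusHaar n) := by
        refine lintegral_mono fun x => ?_
        rw [← ENNReal.ofReal_mul (by positivity)]
        exact ENNReal.ofReal_le_ofReal (hpt x)
    _ ≤ ENNReal.ofReal (P ^ n * Real.exp K) *
          ENNReal.ofReal (n.factorial * Real.exp ((1 - (B + δ))⁻¹ * ∑' m, β m)) := by
        rw [lintegral_const_mul' _ _ ENNReal.ofReal_ne_top]
        gcongr
        exact lintegral_exp_tsum_powerSums_le β hβ0 (by rw [hδ]; linarith) hβ1 hβs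
    _ = _ := by
        rw [← ENNReal.ofReal_mul (by positivity)]
        congr 1
        ring

end Nekrasov

/-! ### The contour integral over Haar measure, and change of radius -/

namespace Nekrasov

open MeasureTheory ComplexConjugate Filter Topology

variable {n : ℕ}

lemma integral_torusHaar (F : (Fin n → UnitAddCircle) → ℂ) :
    ∫ x, F x ∂(torusHaar n) =
      ∫ t in {t : Fin n → ℝ | ∀ i, t i ∈ Set.Ioc (0 : ℝ) (0 + 1)}, F fun i => (t i : UnitAddCircle) :=
  UnitAddTorus.integral_preimage F fun _ => 0

open scoped Pointwise in
lemma integral_torusHaar_eq_integral_Icc (G : (Fin n → ℂ) → ℂ) (ρ : ℝ) :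
    ∫ x, G (fun j => ρ * (fourier 1 (x j) : ℂ)) ∂(torusHaar n) =
      (1 / (2 * Real.pi : ℂ)) ^ n *
        ∫ θ in Set.Icc (0 : Fin n → ℝ) fun _ => 2 * Real.pi, G (torusMap 0 (fun _ => ρ) θ) := by
  have hpi : (0 : ℝ) < 2 * Real.pi := Real.two_pi_pos
  rw [integral_torusHaar]
  have h1 : ∀ t : Fin n → ℝ, G (fun j => ρ * (fourier 1 (t j : UnitAddCircle) : ℂ)) =
      (fun θ => G (torusMap 0 (fun _ => ρ) θ)) ((2 * Real.pi) • t) := by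
    intro t
    beta_reduce
    congr 1
    ext j
    simp only [torusMap, fourier_coe_apply, Pi.smul_apply, smul_eq_mul, Pi.zero_apply, zero_add]
    congr 2
    push_cast
    ring
  simp only [h1]
  rw [Measure.setIntegral_comp_smul_of_pos volume (fun θ => G (torusMap 0 (fun _ => ρ) θ)) _ hpi]
  have hset : (2 * Real.pi) • {t : Fin n → ℝ | ∀ i, t i ∈ Set.Ioc (0 : ℝ) (0 + 1)} =
      Set.univ.pi fun i : Fin n => Set.Ioc ((0 : Fin n → ℝ) i) (2 * Real.pi) := by
    ext t
    rw [Set.mem_smul_set_iff_inv_smul_mem₀ hpi.ne']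
    simp only [Set.mem_ofPred_eq, Pi.smul_apply, smul_eq_mul, Set.mem_Ioc, zero_add, Set.mem_pi,
      Set.mem_univ, true_imp_iff, Pi.zero_apply]
    refine forall_congr' fun i => ?_
    rw [inv_mul_le_iff₀ hpi, mul_one, mul_pos_iff_of_pos_left (inv_pos.2 hpi)]
  have hae : (Set.univ.pi fun i : Fin n => Set.Ioc ((0 : Fin n → ℝ) i) (2 * Real.pi)) =ᵐ[volume]
      Set.Icc (0 : Fin n → ℝ) fun _ => 2 * Real.pi :=
    Measure.univ_pi_Ioc_ae_eq_Icc (μ := fun _ => volume)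
  rw [hset, setIntegral_congr_set hae, Complex.real_smul, Module.finrank_fin_fun, one_div, inv_pow]
  push_cast
  rfl

/-- The integrand of `coeff` with respect to the Haar measure of the torus. -/
noncomputable def fullIntegrand {r s : ℕ} (q₁ q₂ : ℂ) (u : Fin r → ℂ) (p : Fin s → ℂ)
    (z : Fin n → ℂ) : ℂ :=
  (∏ j, ∏ m, (z j - p m)) * integrand q₁ q₂ u z

lemma coeff_eq_integral {r s : ℕ} (q₁ q₂ : ℂ) (u : Fin r → ℂ) (p : Fin s → ℂ) {ρ : ℝ}
    (hρ : 0 < ρ) (n : ℕ) :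
    coeff q₁ q₂ u p ρ n = (1 / (n.factorial : ℂ)) * ((1 - q₁ * q₂) / ((1 - q₁) * (1 - q₂))) ^ n *
      ∫ x, fullIntegrand q₁ q₂ u p (fun j => ρ * (fourier 1 (x j) : ℂ)) ∂(torusHaar n) := by
  rw [integral_torusHaar_eq_integral_Icc, coeff, torusIntegral]
  congr 1
  rw [← integral_const_mul]
  refine setIntegral_congr_fun measurableSet_Icc fun θ _ => ?_
  have hρ' : (ρ : ℂ) ≠ 0 := by exact_mod_cast hρ.ne'
  have hpi : (Real.pi : ℂ) ≠ 0 := by exact_mod_cast Real.pi_ne_zero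
  simp only [fullIntegrand, smul_eq_mul]
  rw [mul_assoc (∏ j, _) (∏ j, _), ← mul_assoc, ← Finset.prod_mul_distrib]
  congr 1
  rw [Finset.prod_eq_pow_card (b := 1 / (2 * (Real.pi : ℂ)))]
  · simp
  · intro i _
    simp only [torusMap, Pi.zero_apply, zero_add]
    have := Complex.exp_ne_zero (θ i * Complex.I)
    have := Complex.I_ne_zero
    field_simp

lemma sub_mul_ne_zero {q z w : ℂ} (hq : ‖q‖ < 1) (hz : 0 < ‖z‖) (h : ‖z‖ = ‖w‖) :
    z - q * w ≠ 0 := by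
  rw [sub_ne_zero]
  intro h'
  have h2 := congrArg norm h'
  rw [norm_mul, ← h] at h2
  nlinarith

lemma potential_denom_ne_zero {q u z : ℂ} (hu : ‖u‖ < ‖z‖) (hq : ‖q‖ * ‖z‖ < ‖u‖) :
    (z - u) * (q * z - u) ≠ 0 := by
  refine mul_ne_zero (sub_ne_zero.2 ?_) (sub_ne_zero.2 ?_)
  · rintro rfl; exact lt_irrefl _ hu
  · rintro rfl; rw [norm_mul] at hq; exact lt_irrefl _ hq

section Deformation

variable {r s : ℕ} {q₁ q₂ : ℂ} {u : Fin r → ℂ} (p : Fin s → ℂ)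

lemma continuous_fullIntegrand {X : Type*} [TopologicalSpace X] (h₁ : ‖q₁‖ < 1) (h₂ : ‖q₂‖ < 1)
    {ρ : ℝ} (hρ : 0 < ρ) (hu : ∀ α, ‖u α‖ < ρ) (hqu : ∀ α, ‖q₁ * q₂‖ * ρ < ‖u α‖)
    {Z : X → Fin n → ℂ} (hZ : Continuous Z) (hZn : ∀ x j, ‖Z x j‖ = ρ) :
    Continuous fun x => fullIntegrand q₁ q₂ u p (Z x) := by
  unfold fullIntegrand integrand
  refine Continuous.mul (by fun_prop) (Continuous.mul ?_ ?_)
  · refine continuous_finsetProd _ fun j _ => continuous_finsetProd _ fun α _ => ?_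
    refine Continuous.div (by fun_prop) (by fun_prop) fun x => potential_denom_ne_zero ?_ ?_
    · rw [hZn]; exact hu α
    · rw [hZn]; exact hqu α
  · refine continuous_finsetProd _ fun jk _ => ?_
    refine Continuous.div (by fun_prop) (by fun_prop) fun x => mul_ne_zero ?_ ?_
    · exact sub_mul_ne_zero h₁ (by rw [hZn]; exact hρ) (by rw [hZn, hZn])
    · exact sub_mul_ne_zero h₂ (by rw [hZn]; exact hρ) (by rw [hZn, hZn])

lemma differentiableAt_fullIntegrand (h₁ : ‖q₁‖ < 1) (h₂ : ‖q₂‖ < 1)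
    {ζ : ℂ} (hζ : 0 < ‖ζ‖) (hu : ∀ α, ‖u α‖ < ‖ζ‖) (hqu : ∀ α, ‖q₁ * q₂‖ * ‖ζ‖ < ‖u α‖)
    {w : Fin n → ℂ} (hw : ∀ j, ‖w j‖ = 1) :
    DifferentiableAt ℂ (fun ζ => fullIntegrand q₁ q₂ u p fun j => ζ * w j) ζ := by
  have hn : ∀ j, ‖ζ * w j‖ = ‖ζ‖ := fun j => by rw [norm_mul, hw, mul_one]
  unfold fullIntegrand integrand
  refine DifferentiableAt.fun_mul (by fun_prop) (DifferentiableAt.fun_mul ?_ ?_)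
  · refine DifferentiableAt.fun_finsetProd fun j _ => DifferentiableAt.fun_finsetProd fun α _ => ?_
    refine DifferentiableAt.fun_div (by fun_prop) (by fun_prop) (potential_denom_ne_zero ?_ ?_)
    · rw [hn]; exact hu α
    · rw [hn]; exact hqu α
  · refine DifferentiableAt.fun_finsetProd fun jk _ => ?_
    refine DifferentiableAt.fun_div (by fun_prop) (by fun_prop) (mul_ne_zero ?_ ?_)
    · exact sub_mul_ne_zero h₁ (by rw [hn]; exact hζ) (by rw [hn, hn])
    · exact sub_mul_ne_zero h₂ (by rw [hn]; exact hζ) (by rw [hn, hn])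

lemma integral_haarAddCircle_eq_circleIntegral (H : ℂ → ℂ) {ρ : ℝ} (hρ : 0 < ρ) :
    ∫ y : UnitAddCircle, H (ρ * (fourier 1 y : ℂ)) ∂AddCircle.haarAddCircle =
      (2 * Real.pi * Complex.I)⁻¹ * ∮ z in C(0, ρ), (z - 0)⁻¹ • H z := by
  have h1 : ∫ y : UnitAddCircle, H (ρ * (fourier 1 y : ℂ)) ∂AddCircle.haarAddCircle =
      ∫ t in (0 : ℝ)..1, H (circleMap 0 ρ (2 * Real.pi * t)) := by
    rw [AddCircle.integral_haarAddCircle, inv_one, one_smul,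
      ← AddCircle.intervalIntegral_preimage 1 0, zero_add]
    refine intervalIntegral.integral_congr fun t _ => ?_
    simp only [circleMap, fourier_coe_apply, zero_add]
    congr 3
    push_cast
    ring
  rw [h1, intervalIntegral.integral_comp_mul_left (fun θ => H (circleMap 0 ρ θ))
    Real.two_pi_pos.ne', mul_zero, mul_one]
  have h2 : ∀ θ : ℝ, deriv (circleMap 0 ρ) θ • ((circleMap 0 ρ θ - 0)⁻¹ • H (circleMap 0 ρ θ)) =
      Complex.I * H (circleMap 0 ρ θ) := by
    intro θ
    have := circleMap_ne_center (c := 0) (R := ρ) (θ := θ) hρ.ne'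
    rw [deriv_circleMap, sub_zero, smul_eq_mul, smul_eq_mul]
    field_simp
  simp only [circleIntegral, h2, intervalIntegral.integral_const_mul, Complex.real_smul]
  have := Complex.I_ne_zero
  push_cast
  field_simp

/-- Haar measure is invariant under a common rotation of all variables; averaging over it leaves,
for each fixed `x`, a one-variable contour integral in a common scale `z`. -/
lemma integral_fullIntegrand_eq_circleIntegral (h₁ : ‖q₁‖ < 1) (h₂ : ‖q₂‖ < 1)
    {ρ : ℝ} (hρ : 0 < ρ) (hu : ∀ α, ‖u α‖ < ρ) (hqu : ∀ α, ‖q₁ * q₂‖ * ρ < ‖u α‖) :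
    ∫ x, fullIntegrand q₁ q₂ u p (fun j => ρ * (fourier 1 (x j) : ℂ)) ∂(torusHaar n) =
      ∫ x, (2 * Real.pi * Complex.I)⁻¹ * ∮ z in C(0, ρ), (z - 0)⁻¹ •
        fullIntegrand q₁ q₂ u p (fun j => z * (fourier 1 (x j) : ℂ)) ∂(torusHaar n) := by
  have h1 : ∀ y : UnitAddCircle,
      ∫ x, fullIntegrand q₁ q₂ u p (fun j => ρ * (fourier 1 (x j) : ℂ)) ∂(torusHaar n) =
      ∫ x, fullIntegrand q₁ q₂ u p (fun j => ρ * (fourier 1 y : ℂ) * (fourier 1 (x j) : ℂ))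
        ∂(torusHaar n) := by
    intro y
    rw [← integral_add_left_eq_self _ (fun _ : Fin n => y)]
    simp only [Pi.add_apply, fourier_one, AddCircle.toCircle_add, Circle.coe_mul, mul_assoc]
  calc _ = ∫ _y : UnitAddCircle, ∫ x, fullIntegrand q₁ q₂ u p
          (fun j => ρ * (fourier 1 (x j) : ℂ)) ∂(torusHaar n) ∂AddCircle.haarAddCircle := by simp
    _ = ∫ y : UnitAddCircle, ∫ x, fullIntegrand q₁ q₂ u p
          (fun j => ρ * (fourier 1 y : ℂ) * (fourier 1 (x j) : ℂ)) ∂(torusHaar n)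
          ∂AddCircle.haarAddCircle := by simp only [← h1]
    _ = ∫ x, ∫ y : UnitAddCircle, fullIntegrand q₁ q₂ u p
          (fun j => ρ * (fourier 1 y : ℂ) * (fourier 1 (x j) : ℂ)) ∂AddCircle.haarAddCircle
          ∂(torusHaar n) := by
        refine integral_integral_swap (Continuous.integrable_of_hasCompactSupport ?_
          (HasCompactSupport.of_compactSpace _))
        refine continuous_fullIntegrand (X := UnitAddCircle × (Fin n → UnitAddCircle)) p h₁ h₂ hρ
          hu hqu (by fun_prop) fun x j => ?_
        rw [norm_mul, norm_mul, norm_fourier, norm_fourier, mul_one, mul_one, Complex.norm_real,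
          Real.norm_of_nonneg hρ.le]
    _ = _ := integral_congr_ae (Eventually.of_forall fun x =>
        integral_haarAddCircle_eq_circleIntegral
          (fun z => fullIntegrand q₁ q₂ u p (fun j => z * (fourier 1 (x j) : ℂ))) hρ)

/-- All radii are scaled together, so `|z_j| = |z_k|` throughout and the poles at `z_j = q_i z_k`
are never met; the poles coming from `u` lie outside the annulus. Cauchy's theorem in the single
scale variable then suffices. -/
lemma coeff_eq_of_le (h₁ : ‖q₁‖ < 1) (h₂ : ‖q₂‖ < 1) {ρ₁ ρ₂ : ℝ} (h0 : 0 < ρ₁) (hle : ρ₁ ≤ ρ₂)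
    (hu : ∀ α, ‖u α‖ < ρ₁) (hqu : ∀ α, ‖q₁ * q₂‖ * ρ₂ < ‖u α‖) (n : ℕ) :
    coeff q₁ q₂ u p ρ₂ n = coeff q₁ q₂ u p ρ₁ n := by
  have hqu' : ∀ ρ ≤ ρ₂, ∀ α, ‖q₁ * q₂‖ * ρ < ‖u α‖ := fun ρ hρ α =>
    (mul_le_mul_of_nonneg_left hρ (norm_nonneg _)).trans_lt (hqu α)
  rw [coeff_eq_integral q₁ q₂ u p h0, coeff_eq_integral q₁ q₂ u p (h0.trans_le hle),
    integral_fullIntegrand_eq_circleIntegral p h₁ h₂ h0 hu (hqu' _ hle),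
    integral_fullIntegrand_eq_circleIntegral p h₁ h₂ (h0.trans_le hle)
      (fun α => (hu α).trans_le hle) hqu]
  congr 1
  refine integral_congr_ae (Eventually.of_forall fun x => ?_)
  simp only
  congr 1
  have hd : ∀ z : ℂ, ρ₁ ≤ ‖z‖ → ‖z‖ ≤ ρ₂ → DifferentiableAt ℂ
      (fun z => fullIntegrand q₁ q₂ u p (fun j => z * (fourier 1 (x j) : ℂ))) z :=
    fun z hz hz' => differentiableAt_fullIntegrand p h₁ h₂ (h0.trans_le hz)
      (fun α => (hu α).trans_le hz) (hqu' _ hz') fun j => norm_fourier _ _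
  refine Complex.circleIntegral_sub_center_inv_smul_eq_of_differentiable_on_annulus_off_countable
    h0 hle Set.countable_empty ?_ ?_
  · intro z hz
    simp only [Set.mem_sdiff, Metric.mem_closedBall, Metric.mem_ball, dist_zero_right, not_lt] at hz
    exact (hd z hz.2 hz.1).continuousAt.continuousWithinAt
  · intro z hz
    simp only [Set.mem_sdiff, Metric.mem_closedBall, Metric.mem_ball, dist_zero_right, not_le] at hz
    exact hd z hz.1.2.le hz.1.1.le

end Deformation

/-! ### From the integral bound to the growth rate -/

lemma exists_enorm_coeff_le {r s : ℕ} {q₁ q₂ : ℂ} (h₁ : ‖q₁‖ < 1) (h₂ : ‖q₂‖ < 1)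
    (hq : q₁ = conj q₂ ∨
      ∃ x₁ ∈ Set.Ioo (0 : ℝ) 1, ∃ x₂ ∈ Set.Ioo (0 : ℝ) 1, q₁ = (x₁ : ℂ) ∧ q₂ = (x₂ : ℂ))
    {u : Fin r → ℂ} {p : Fin s → ℂ} {ρ : ℝ} (hρ : 0 < ρ) (hu : ∀ α, ‖u α‖ < ρ)
    (hqu : ∀ α, ‖q₁ * q₂‖ * ρ < ‖u α‖) (hp : ∀ m, ‖p m‖ ≠ ρ) :
    ∃ C : ℝ, 0 < C ∧ ∀ n : ℕ,
      ‖coeff q₁ q₂ u p ρ n‖ₑ ≤ ENNReal.ofReal (C * (∏ m, max ‖p m‖ ρ) ^ n) := by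
  obtain ⟨C, hC, h⟩ := exists_lintegral_integrand_le h₁ h₂ hq hρ hu hqu hp
  refine ⟨C, hC, fun n => ?_⟩
  have hn : (0 : ℝ) < n.factorial := by positivity
  rw [coeff_eq_integral q₁ q₂ u p hρ, mul_assoc, ← integral_const_mul, enorm_mul]
  calc _ ≤ ‖1 / (n.factorial : ℂ)‖ₑ *
        ENNReal.ofReal (n.factorial * (C * (∏ m, max ‖p m‖ ρ) ^ n)) := by
        refine mul_le_mul_right ((enorm_integral_le_lintegral_enorm _).trans
          ((lintegral_mono fun x => ?_).trans (h n))) _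
        rw [← ofReal_norm, norm_mul, norm_pow, fullIntegrand]
    _ = _ := by
        rw [← ofReal_norm, ← ENNReal.ofReal_mul (norm_nonneg _), norm_div, norm_one,
          Complex.norm_natCast]
        congr 1
        field_simp

lemma limsup_rpow_le {a : ℕ → ℝ≥0∞} {C P : ℝ} (hC : 0 < C) (hP : 0 ≤ P)
    (h : ∀ n, a n ≤ ENNReal.ofReal (C * P ^ n)) :
    limsup (fun n : ℕ => a n ^ (1 / (n : ℝ))) atTop ≤ ENNReal.ofReal P := by
  have hlim : Tendsto (fun n : ℕ => ENNReal.ofReal (C ^ (1 / (n : ℝ)) * P)) atTop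
      (𝓝 (ENNReal.ofReal P)) := by
    refine ENNReal.tendsto_ofReal ?_
    have h1 := ((Real.continuous_const_rpow hC.ne').tendsto 0).comp
      tendsto_one_div_atTop_nhds_zero_nat
    rw [Real.rpow_zero] at h1
    simpa using h1.mul_const P
  rw [← hlim.limsup_eq]
  refine limsup_le_limsup ?_
  -- At `n = 0` the exponent `1 / n` is `0` by convention, so that index is discarded.
  filter_upwards [eventually_ge_atTop 1] with n hn
  have hn0 : (n : ℝ) ≠ 0 := by positivity
  calc a n ^ (1 / (n : ℝ)) ≤ ENNReal.ofReal (C * P ^ n) ^ (1 / (n : ℝ)) :=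
        ENNReal.rpow_le_rpow (h n) (by positivity)
    _ = ENNReal.ofReal (C ^ (1 / (n : ℝ)) * P) := by
        rw [ENNReal.ofReal_rpow_of_nonneg (by positivity) (by positivity),
          Real.mul_rpow hC.le (by positivity), ← Real.rpow_natCast, ← Real.rpow_mul hP,
          mul_one_div_cancel hn0, Real.rpow_one]

end Nekrasov

open Filter Topology

theorem mainTheorem3 (q₁ q₂ : ℂ)
    (hq₁ : 0 < ‖q₁‖ ∧ ‖q₁‖ < 1) (hq₂ : 0 < ‖q₂‖ ∧ ‖q₂‖ < 1)
    (hq : q₁ = (starRingEnd ℂ) q₂ ∨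
      ∃ x₁ ∈ Set.Ioo (0 : ℝ) 1, ∃ x₂ ∈ Set.Ioo (0 : ℝ) 1, q₁ = (x₁ : ℂ) ∧ q₂ = (x₂ : ℂ))
    (r s : ℕ) (hr : 1 ≤ r) (u : Fin r → ℂ) (p : Fin s → ℂ)
    (hu₁ : ‖q₁‖ * (⨆ α, ‖u α‖) < ⨅ α, ‖u α‖)
    (hu₂ : ‖q₂‖ * (⨆ α, ‖u α‖) < ⨅ α, ‖u α‖)
    (ρ : ℝ) (hρ : Nekrasov.IsAdmissibleRadius q₁ q₂ u ρ) :
    Filter.limsup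
        (fun n : ℕ => (‖Nekrasov.coeff q₁ q₂ u p ρ n‖ₑ : ℝ≥0∞) ^ (1 / (n : ℝ))) Filter.atTop
      ≤ ENNReal.ofReal (∏ m, max ‖p m‖ (⨆ α, ‖u α‖)) := by
  obtain ⟨hρ0, hadm⟩ := hρ
  have : Nonempty (Fin r) := ⟨⟨0, hr⟩⟩
  set M := ⨆ α, ‖u α‖ with hM
  have hle : ∀ α, ‖u α‖ ≤ M := le_ciSup (Set.finite_range _).bddAbove
  have hM0 : 0 ≤ M := (norm_nonneg _).trans (hle ⟨0, hr⟩)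
  have hMρ : M < ρ := by
    obtain ⟨α, hα⟩ := exists_eq_ciSup_of_finite (f := fun α => ‖u α‖)
    rw [hM, ← hα]
    exact (hadm α).1
  have hqu : ∀ α, ‖q₁ * q₂‖ * ρ < ‖u α‖ := by
    intro α
    have h := (hadm α).2.1
    rw [lt_inv_mul_iff₀ hq₁.1] at h
    rw [norm_mul]
    refine lt_of_le_of_lt ?_ h
    have := mul_le_of_le_one_right hq₁.1.le hq₂.2.le
    gcongr
  have hlim : Tendsto (fun ρ' : ℝ => ENNReal.ofReal (∏ m, max ‖p m‖ ρ')) (𝓝[>] M)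
      (𝓝 (ENNReal.ofReal (∏ m, max ‖p m‖ M))) :=
    (ENNReal.continuous_ofReal.comp (by fun_prop :
      Continuous fun ρ' : ℝ => ∏ m, max ‖p m‖ ρ')).continuousAt.tendsto.mono_left nhdsWithin_le_nhds
  -- The estimate needs a radius different from every `‖p m‖`; all radii just above `M` qualify,
  -- even when some `‖p m‖` equals `M`.
  have hgen : ∀ᶠ ρ' in 𝓝[>] M, ∀ m, ‖p m‖ ≠ ρ' := by
    refine eventually_all.2 fun m => ?_
    rcases le_or_gt ‖p m‖ M with h | h
    · filter_upwards [self_mem_nhdsWithin] with ρ' hρ'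
      exact (h.trans_lt hρ').ne
    · filter_upwards [(eventually_lt_nhds h).filter_mono nhdsWithin_le_nhds] with ρ' hρ'
      exact hρ'.ne'
  refine ge_of_tendsto hlim ?_
  filter_upwards [hgen, self_mem_nhdsWithin,
    (eventually_lt_nhds hMρ).filter_mono nhdsWithin_le_nhds] with ρ' hp hMρ' hρ'
  replace hMρ' : M < ρ' := hMρ'
  have hρ'0 : 0 < ρ' := hM0.trans_lt hMρ'
  have hu : ∀ α, ‖u α‖ < ρ' := fun α => (hle α).trans_lt hMρ'
  have hqu' : ∀ α, ‖q₁ * q₂‖ * ρ' < ‖u α‖ := fun α =>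
    (mul_le_mul_of_nonneg_left hρ'.le (norm_nonneg _)).trans_lt (hqu α)
  obtain ⟨C, hC, h⟩ := Nekrasov.exists_enorm_coeff_le hq₁.2 hq₂.2 hq hρ'0 hu hqu' hp
  refine Nekrasov.limsup_rpow_le hC
    (Finset.prod_nonneg fun m _ => hρ'0.le.trans (le_max_right _ _)) fun n => ?_
  rw [Nekrasov.coeff_eq_of_le p hq₁.2 hq₂.2 hρ'0 hρ'.le hu hqu]
  exact h n
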